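/- **Theorem 5.4.** Let $\mathbb{K}$ be a field and let $\mathcal{A}=\{a_1,\dots,a_n\}\subset\mathbb{Z}^d$ be a set of $n\ge 1$ distinct points that spans $\mathbb{Q}^d$ and for which some $\omega\in\mathbb{Q}^d$ satisfies $\omega^T a_i=1$ for all $i$. Let $I_{\mathcal{A}}$ be the toric ideal of $\mathcal{A}$, that is, the kernel of $\mathbb{K}[x_1,\dots,x_n]\to\mathbb{K}[t_1^{\pm1},\dots,t_d^{\pm1}]$, $x_j\mapsto t^{a_j}$, and let $X_{\mathcal{A}}\subset\mathbb{P}^{n-1}$ be the projective toric variety that it defines. For $r\ge 1$ let $X_{\mathcal{A}}^{\{r\}}\subset\mathbb{P}^{n-1}$ be the $r$-th secant variety, defined by the secant ideal $$I_{\mathcal{A}}^{\{r\}}=\Bigl(I_{\mathcal{A}}(\mathbf{y}_1)+\cdots+I_{\mathcal{A}}(\mathbf{y}_r)+\langle\, y_{1i}+\cdots+y_{ri}-x_i : 1\le i\le n\,\rangle\Bigr)\cap\mathbb{K}[x_1,\dots,x_n],$$ where $\mathbf{y}_j=(y_{j1},\dots,y_{jn})$ are new unknowns. When $\mathbb{K}$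 is algebraically closed, the conclusions below are also asserted for $X_{\mathcal{A}}^{\{r\}}$ defined as the Zariski closure of the union of the linear spans of $r$ points of $X_{\mathcal{A}}$. Let $\Delta$ be a regular triangulation of $\mathcal{A}$: there are heights $w\in\mathbb{R}^n$ such that the simplices of $\Delta$ are exactly the sets $\{a_i : i\in\sigma\}$ for which some $c\in\mathbb{R}^d$ has $c^Ta_i=w_i$ for $i\in\sigma$ and $c^Ta_i<w_i$ for $i\notin\sigma$, and each of these sets is linearly independent. A subset of $\mathcal{A}$ is called $r$-partitionable if it is the union of $r$ pairwise disjoint maximal simplices of $\Delta$. If $\Delta$ has at least one $r$-partitionable set, then $X_{\mathcal{A}}^{\{r\}}$ has the expected dimension $\min(rd-1,\,n-1)$, and the degree of $X_{\mathcal{A}}^{\{r\}}$ is at least the number of $r$-partitionable sets of $\Delta$. -/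

import Mathlib

open MvPolynomial
open scoped LinearAlgebra.Projectivization

noncomputable section

namespace ToricSecant

/-- The toric ideal `I_A` of a configuration `a 0, …, a (n-1)` in `ℤ ^ d`: the kernel of
`K[x_1, …, x_n] → K[t_1^±1, …, t_d^±1]`, `x_j ↦ t ^ (a j)`. The Laurent polynomial ring is the
group algebra of `ℤ ^ d`. -/
def toricIdeal (K : Type*) [Field K] {n d : ℕ} (a : Fin n → Fin d → ℤ) :
    Ideal (MvPolynomial (Fin n) K) :=
  RingHom.ker (aeval (fun j => (AddMonoidAlgebra.single (a j) 1 :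
    AddMonoidAlgebra K (Fin d → ℤ))) : MvPolynomial (Fin n) K →ₐ[K] _)

/-- The join `I_1 * ⋯ * I_r` of ideals of `K[x_1, …, x_n]`: the elimination ideal
`(I_1(y_1) + ⋯ + I_r(y_r) + ⟨y_{1i} + ⋯ + y_{ri} - x_i : i⟩) ∩ K[x]`. The variable `x_i` is
`Sum.inl i`, the variable `y_{ji}` is `Sum.inr (j, i)`. -/
def idealJoin {K : Type*} [Field K] {n r : ℕ} (I : Fin r → Ideal (MvPolynomial (Fin n) K)) :
    Ideal (MvPolynomial (Fin n) K) :=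
  Ideal.comap
    (rename Sum.inl : MvPolynomial (Fin n) K →ₐ[K] MvPolynomial (Fin n ⊕ Fin r × Fin n) K)
    ((⨆ j, (I j).map (rename (fun i => Sum.inr (j, i)) :
        MvPolynomial (Fin n) K →ₐ[K] MvPolynomial (Fin n ⊕ Fin r × Fin n) K)) ⊔
      Ideal.span (Set.range fun i : Fin n =>
        (∑ j : Fin r, X (Sum.inr (j, i))) - X (Sum.inl i)))

/-- The `r`-th secant `I^{r}` of an ideal: its `r`-fold join with itself. -/
def secantIdeal {K : Type*} [Field K] {n : ℕ} (I : Ideal (MvPolynomial (Fin n) K)) (r : ℕ) :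
    Ideal (MvPolynomial (Fin n) K) :=
  idealJoin (fun _ : Fin r => I)

/-- The zero set in `ℙ^(n-1)(K)` of a homogeneous ideal. -/
def projZeroLocus {K : Type*} [Field K] {n : ℕ} (I : Ideal (MvPolynomial (Fin n) K)) :
    Set (ℙ K (Fin n → K)) :=
  {p | ∀ f ∈ I, ∀ v ∈ p.submodule, eval v f = 0}

/-- The affine cone over a subset of projective space. -/
def affineCone {K : Type*} [Field K] {n : ℕ} (S : Set (ℙ K (Fin n → K))) : Set (Fin n → K) :=
  {v | ∃ p ∈ S, v ∈ p.submodule}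

/-- The vanishing ideal of a subset of projective space over an infinite field: the polynomials
that vanish on the affine cone (over an infinite field this ideal is homogeneous). -/
def projVanishingIdeal {K : Type*} [Field K] {n : ℕ} (S : Set (ℙ K (Fin n → K))) :
    Ideal (MvPolynomial (Fin n) K) :=
  vanishingIdeal K (affineCone S)

/-- The Zariski closure of a subset of projective space. -/
def zariskiClosure {K : Type*} [Field K] {n : ℕ} (S : Set (ℙ K (Fin n → K))) :
    Set (ℙ K (Fin n → K)) :=
  projZeroLocus (projVanishingIdeal S)

/-- The `r`-th secant variety `X^{r}` of `X ⊆ ℙ^(n-1)`: the Zariski closure of the union of the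
linear spans of `r` points of `X`. -/
def secantVariety {K : Type*} [Field K] {n : ℕ} (X : Set (ℙ K (Fin n → K))) (r : ℕ) :
    Set (ℙ K (Fin n → K)) :=
  zariskiClosure {p | ∃ q : Fin r → ℙ K (Fin n → K),
    (∀ j, q j ∈ X) ∧ p.submodule ≤ ⨆ j, (q j).submodule}

/-- The projective scheme defined by the homogeneous ideal `I` has dimension `m`: its homogeneous
coordinate ring has Krull dimension `m + 1`. -/
def HasProjDim {K : Type*} [Field K] {n : ℕ} (I : Ideal (MvPolynomial (Fin n) K)) (m : ℕ) :
    Prop :=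
  ringKrullDim (MvPolynomial (Fin n) K ⧸ I) = ((m + 1 : ℕ) : WithBot ℕ∞)

/-- The Hilbert function of `K[x]/I`: the dimension of the degree `k` part of `K[x]/I`, for a
homogeneous ideal `I`. -/
def hilbertFunction {K : Type*} [Field K] {n : ℕ} (I : Ideal (MvPolynomial (Fin n) K)) (k : ℕ) :
    ℕ :=
  Module.finrank K
    ((homogeneousSubmodule (Fin n) K k).map (Ideal.Quotient.mkₐ K I).toLinearMap)

/-- `P` is the Hilbert polynomial of `K[x]/I`. -/
def IsHilbertPolynomial {K : Type*} [Field K] {n : ℕ} (I : Ideal (MvPolynomial (Fin n) K))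
    (P : Polynomial ℚ) : Prop :=
  ∀ᶠ k : ℕ in Filter.atTop, P.eval (k : ℚ) = (hilbertFunction I k : ℚ)

/-- The (nonempty) projective scheme defined by the homogeneous ideal `I` has degree `D`:
the Hilbert polynomial of `K[x]/I` is `D / m! * k ^ m + (lower order terms)` and nonzero. -/
def HasDegree {K : Type*} [Field K] {n : ℕ} (I : Ideal (MvPolynomial (Fin n) K)) (D : ℕ) : Prop :=
  ∃ P : Polynomial ℚ, IsHilbertPolynomial I P ∧ P ≠ 0 ∧
    (D : ℚ) = (Nat.factorial P.natDegree : ℚ) * P.leadingCoeff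

/-- The expected dimension `min (r d - 1, n - 1)` of the `r`-th secant variety of a
`(d-1)`-dimensional subvariety of `ℙ^(n-1)` (used for `r, d, n ≥ 1` only). -/
def expectedDim (n d r : ℕ) : ℕ := min (r * d - 1) (n - 1)

/-- `σ` is a cell of the regular subdivision of the configuration `a` given by the heights `w`:
some linear functional agrees with the heights on `σ` and lies strictly below them elsewhere. -/
def IsRegularCell {n d : ℕ} (a : Fin n → Fin d → ℤ) (w : Fin n → ℝ) (σ : Finset (Fin n)) : Prop :=
  ∃ c : Fin d → ℝ, (∀ i ∈ σ, ∑ k, c k * (a i k : ℝ) = w i) ∧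
    ∀ i ∉ σ, ∑ k, c k * (a i k : ℝ) < w i

/-- `Δ` (a collection of sets of indices of points) is a regular triangulation of the
configuration `a`: it is the regular subdivision for some height vector, and every cell is a
simplex. As the points of the configurations considered lie on a hyperplane that misses the
origin, affine and linear independence of such points agree. -/
def IsRegularTriangulation {n d : ℕ} (a : Fin n → Fin d → ℤ) (Δ : Set (Finset (Fin n))) : Prop :=
  ∃ w : Fin n → ℝ, (∀ σ, σ ∈ Δ ↔ IsRegularCell a w σ) ∧
    ∀ σ ∈ Δ, LinearIndependent ℝ (fun i : σ => fun k => (a i k : ℝ))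

/-- `C` is `r`-partitionable: it is the disjoint union of `r` maximal simplices of `Δ`. -/
def IsPartitionable {n : ℕ} (Δ : Set (Finset (Fin n))) (r : ℕ) (C : Finset (Fin n)) : Prop :=
  ∃ σ : Fin r → Finset (Fin n), (∀ j, Maximal (· ∈ Δ) (σ j)) ∧
    (∀ i j, i ≠ j → Disjoint (σ i) (σ j)) ∧ C = Finset.univ.biUnion σ

end ToricSecant

end

/-!
# Secant varieties of toric varieties and regular triangulations

Write `t_1, …, t_r` for vectors of `d` unknowns. The secant ideal of the toric ideal of `a` is the
kernel of `x_i ↦ t_1^(a i) + ⋯ + t_r^(a i)` (`secantIdeal_toricIdeal`), so it is prime, and it is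
homogeneous for the grading in which `t_j^(a i)` has degree `ω · a i = 1`.

Let `w` be heights that induce the triangulation, and let `C` be the disjoint union of maximal cells
`σ_1, …, σ_r` with supporting functionals `c_1, …, c_r`. Give `t_j` the weight `c_j`. Then
`t_j^(a i)` has weight at most `w i`, with equality exactly for `i ∈ σ_j`. Hence the image of `x^u` has weight
at most `w · u`, and its part of weight `w · u` is a single Laurent monomial if `u` is supported on
`C` and is zero otherwise (`coeff_secantParam_monomial_of_weight_le`). As the cells are linearly
independent, this Laurent monomial determines `u`. In a polynomial all of whose monomials are
supported on partitionable sets, a monomial of maximal height is therefore not cancelled by the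
others in the image: such monomials are linearly independent modulo the secant ideal
(`eq_zero_of_secantParam_eq_zero`).

A maximal cell has `d` elements (`card_eq_of_maximal`), so each partitionable set has `r * d`
elements. Counting monomials with support exactly `C`, for `N` partitionable sets `C`, bounds the
Hilbert function at `k` below by `N * choose (k - 1) (r * d - 1)`. Above it is
`O(k ^ (r * d - 1))`, because the Laurent monomials that occur lie in a box of side `O(k)` and on a
hyperplane. A Hilbert polynomial exists (`exists_isHilbertPolynomial`), so it has degree `r * d - 1`
and leading coefficient at least `N / (r * d - 1)!`. For the Krull dimension, the variables in
one partitionable set are algebraically independent, and the Laurent polynomial ring has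
transcendence degree at most `r * d`.

Over an algebraically closed field the sums of `r` torus points of the affine cone lie in the cone
over the union of secant planes, and a polynomial that vanishes on all of them has zero image
because distinct characters of the torus are linearly independent
(`projVanishingIdeal_secantVariety`). So the secant variety has the same ideal.
-/

namespace ToricSecant

/-! ### Hilbert polynomials of homogeneous ideals -/

section HilbertPolynomial

theorem exists_polynomial_antidifference (P : Polynomial ℚ) :
    ∃ Q : Polynomial ℚ, ∀ x : ℚ, Q.eval (x + 1) - Q.eval x = P.eval x := by
  induction P using Polynomial.induction_on' with
  | add p q hp hq =>
    obtain ⟨p', hp'⟩ := hp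
    obtain ⟨q', hq'⟩ := hq
    refine ⟨p' + q', fun x => ?_⟩
    rw [Polynomial.eval_add, Polynomial.eval_add, Polynomial.eval_add, ← hp', ← hq']
    ring
  | monomial j c =>
    refine ⟨Polynomial.C (c / (j + 1)) * Polynomial.bernoulli (j + 1), fun x => ?_⟩
    have h : (j + 1 : ℚ) ≠ 0 := by positivity
    rw [Polynomial.eval_mul, Polynomial.eval_mul, Polynomial.eval_C, add_comm x 1,
      Polynomial.bernoulli_eval_one_add, Polynomial.eval_monomial]
    push_cast
    rw [Polynomial.eval_C]
    field_simp
    ring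

theorem exists_polynomial_of_difference {f : ℕ → ℚ} {P : Polynomial ℚ}
    (h : ∀ᶠ k : ℕ in Filter.atTop, P.eval (k : ℚ) = f (k + 1) - f k) :
    ∃ Q : Polynomial ℚ, ∀ᶠ k : ℕ in Filter.atTop, Q.eval (k : ℚ) = f k := by
  obtain ⟨Q, hQ⟩ := exists_polynomial_antidifference P
  obtain ⟨N, hN⟩ := Filter.eventually_atTop.1 h
  refine ⟨Q + Polynomial.C (f N - Q.eval (N : ℚ)), Filter.eventually_atTop.2 ⟨N, fun k hk => ?_⟩⟩
  rw [Polynomial.eval_add, Polynomial.eval_C]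
  induction k, hk using Nat.le_induction with
  | base => ring
  | succ k hk ih =>
    have h1 := hN k hk
    have h2 := hQ k
    push_cast
    linarith

variable {K : Type*} [Field K] {n : ℕ}

theorem homogeneousComponent_X_mul {σ : Type*} (i : σ) (k : ℕ) (f : MvPolynomial σ K) :
    homogeneousComponent (k + 1) (X i * f) = X i * homogeneousComponent k f := by
  classical
  ext d
  rw [coeff_homogeneousComponent, coeff_X_mul', coeff_X_mul', coeff_homogeneousComponent]
  by_cases hi : i ∈ d.support
  · have hd : Finsupp.single i 1 ≤ d := by
      rw [Finsupp.single_le_iff]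
      exact Nat.one_le_iff_ne_zero.2 (Finsupp.mem_support_iff.1 hi)
    have h : (d - Finsupp.single i 1).degree + 1 = d.degree := by
      conv_rhs => rw [← tsub_add_cancel_of_le hd, map_add, Finsupp.degree_single]
    simp only [hi, if_true, ← h, Nat.add_right_cancel_iff]
  · simp [hi]

/-- The degree `k` part of an ideal of a polynomial ring. -/
noncomputable def gradedPart (I : Ideal (MvPolynomial (Fin n) K)) (k : ℕ) :
    Submodule K (MvPolynomial (Fin n) K) :=
  I.restrictScalars K ⊓ homogeneousSubmodule (Fin n) K k

instance finite_homogeneousSubmodule (k : ℕ) :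
    Module.Finite K (homogeneousSubmodule (Fin n) K k) :=
  Module.Finite.iff_fg.2 (homogeneousSubmodule_fg (Fin n) K k)

instance finite_gradedPart (I : Ideal (MvPolynomial (Fin n) K)) (k : ℕ) :
    Module.Finite K (gradedPart I k) :=
  Submodule.finiteDimensional_of_le inf_le_right

theorem hilbertFunction_add_finrank_gradedPart (I : Ideal (MvPolynomial (Fin n) K)) (k : ℕ) :
    hilbertFunction I k + Module.finrank K (gradedPart I k) =
      Module.finrank K (homogeneousSubmodule (Fin n) K k) := by
  have h := LinearMap.finrank_range_add_finrank_ker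
    ((Ideal.Quotient.mkₐ K I).toLinearMap.domRestrict (homogeneousSubmodule (Fin n) K k))
  rw [← h, hilbertFunction, LinearMap.range_domRestrict]
  congr 1
  rw [← Submodule.finrank_map_subtype_eq]
  have e : gradedPart I k = (LinearMap.ker ((Ideal.Quotient.mkₐ K I).toLinearMap.domRestrict
      (homogeneousSubmodule (Fin n) K k))).map (homogeneousSubmodule (Fin n) K k).subtype := by
    ext f
    simp [gradedPart, Ideal.Quotient.eq_zero_iff_mem, and_comm]
  rw [e]

/-- The colon ideal `I : x_i`. -/
noncomputable def colonX (I : Ideal (MvPolynomial (Fin n) K)) (i : Fin n) :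
    Ideal (MvPolynomial (Fin n) K) :=
  Submodule.comap (LinearMap.mulLeft (MvPolynomial (Fin n) K) (X i)) I

theorem mem_colonX {I : Ideal (MvPolynomial (Fin n) K)} {i : Fin n}
    {f : MvPolynomial (Fin n) K} : f ∈ colonX I i ↔ X i * f ∈ I := Iff.rfl

theorem le_colonX (I : Ideal (MvPolynomial (Fin n) K)) (i : Fin n) : I ≤ colonX I i :=
  fun _ hf => I.mul_mem_left _ hf

theorem homogeneousComponent_mem_colonX {I : Ideal (MvPolynomial (Fin n) K)}
    (hI : ∀ f ∈ I, ∀ k, homogeneousComponent k f ∈ I) (i : Fin n) :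
    ∀ f ∈ colonX I i, ∀ k, homogeneousComponent k f ∈ colonX I i := by
  intro f hf k
  rw [mem_colonX, ← homogeneousComponent_X_mul]
  exact hI _ hf _

theorem homogeneousComponent_mem_sup_span_X {I : Ideal (MvPolynomial (Fin n) K)}
    (hI : ∀ f ∈ I, ∀ k, homogeneousComponent k f ∈ I) (i : Fin n) :
    ∀ f ∈ I ⊔ Ideal.span {X i}, ∀ k, homogeneousComponent k f ∈ I ⊔ Ideal.span {X i} := by
  intro f hf k
  obtain ⟨g, hg, h, hh, rfl⟩ := Submodule.mem_sup.1 hf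
  obtain ⟨q, rfl⟩ := Ideal.mem_span_singleton'.1 hh
  rw [map_add]
  refine Ideal.add_mem _ (Ideal.mem_sup_left (hI g hg k)) (Ideal.mem_sup_right ?_)
  rw [mul_comm]
  cases k with
  | zero =>
    have h0 : coeff 0 (X i * q) = 0 := by
      rw [← constantCoeff_eq, map_mul, constantCoeff_X, zero_mul]
    rw [homogeneousComponent_zero, h0, C_0]
    exact zero_mem _
  | succ k =>
    rw [homogeneousComponent_X_mul]
    exact Ideal.mul_mem_right _ _ (Ideal.mem_span_singleton_self _)

/-- The Hilbert function counts along the exact sequence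
`0 → (S/(I : x_i))(-1) → S/I → S/(I + ⟨x_i⟩) → 0`. -/
theorem hilbertFunction_succ {I : Ideal (MvPolynomial (Fin n) K)}
    (hI : ∀ f ∈ I, ∀ k, homogeneousComponent k f ∈ I) (i : Fin n) (k : ℕ) :
    hilbertFunction I (k + 1) =
      hilbertFunction (colonX I i) k + hilbertFunction (I ⊔ Ideal.span {X i}) (k + 1) := by
  have hinj : Function.Injective (LinearMap.mulLeft K (X i : MvPolynomial (Fin n) K)) :=
    fun f g h => mul_left_cancel₀ (X_ne_zero i) h
  have hsup : gradedPart (I ⊔ Ideal.span {X i}) (k + 1) = gradedPart I (k + 1) ⊔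
      (homogeneousSubmodule (Fin n) K k).map (LinearMap.mulLeft K (X i)) := by
    apply le_antisymm
    · rintro f ⟨hf, hd⟩
      obtain ⟨g, hg, h, hh, rfl⟩ := Submodule.mem_sup.1 hf
      obtain ⟨q, rfl⟩ := Ideal.mem_span_singleton'.1 hh
      rw [← homogeneousComponent_eq_self (p := g + q * X i) hd, map_add, mul_comm,
        homogeneousComponent_X_mul]
      exact Submodule.add_mem_sup ⟨hI g hg _, homogeneousComponent_mem _ _⟩
        ⟨_, homogeneousComponent_mem _ _, rfl⟩
    · refine sup_le (fun f hf => ⟨Ideal.mem_sup_left hf.1, hf.2⟩) ?_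
      rintro _ ⟨q, hq, rfl⟩
      refine ⟨Ideal.mem_sup_right (Ideal.mul_mem_right _ _ (Ideal.mem_span_singleton_self _)), ?_⟩
      have := (isHomogeneous_X K i).mul hq
      rwa [add_comm] at this
  -- the two summands meet in the degree `k` part of the colon ideal, multiplied by `x_i`
  have hinf : gradedPart I (k + 1) ⊓
      (homogeneousSubmodule (Fin n) K k).map (LinearMap.mulLeft K (X i)) =
      (gradedPart (colonX I i) k).map (LinearMap.mulLeft K (X i)) := by
    ext f
    constructor
    · rintro ⟨⟨h1, -⟩, q, hq, rfl⟩
      exact ⟨q, ⟨h1, hq⟩, rfl⟩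
    · rintro ⟨q, ⟨h1, hq⟩, rfl⟩
      refine ⟨⟨h1, ?_⟩, q, hq, rfl⟩
      have := (isHomogeneous_X K i).mul hq
      rwa [add_comm] at this
  have h := Submodule.finrank_sup_add_finrank_inf_eq (gradedPart I (k + 1))
    ((homogeneousSubmodule (Fin n) K k).map (LinearMap.mulLeft K (X i)))
  rw [← hsup, hinf, ← (Submodule.equivMapOfInjective _ hinj _).finrank_eq,
    ← (Submodule.equivMapOfInjective _ hinj _).finrank_eq] at h
  have h1 := hilbertFunction_add_finrank_gradedPart I (k + 1)
  have h2 := hilbertFunction_add_finrank_gradedPart (colonX I i) k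
  have h3 := hilbertFunction_add_finrank_gradedPart (I ⊔ Ideal.span {X i}) (k + 1)
  omega

theorem hilbertFunction_eq_zero_of_X_mem {I : Ideal (MvPolynomial (Fin n) K)}
    (hI : ∀ i, X i ∈ I) {k : ℕ} (hk : 0 < k) : hilbertFunction I k = 0 := by
  have h : gradedPart I k = homogeneousSubmodule (Fin n) K k := by
    refine le_antisymm inf_le_right (le_inf (fun f hf => ?_) le_rfl)
    have hspan : Ideal.span (X '' (Set.univ : Set (Fin n))) ≤ I := by
      rw [Ideal.span_le]
      rintro _ ⟨i, -, rfl⟩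
      exact hI i
    refine hspan (mem_ideal_span_X_image.2 fun m hm => ?_)
    by_contra! hc
    have hm0 : m = 0 := Finsupp.ext fun i => hc i trivial
    have := IsHomogeneous.coeff_eq_zero hf (d := m) (by rw [hm0, map_zero]; exact hk.ne)
    exact mem_support_iff.1 hm this
  have h1 := hilbertFunction_add_finrank_gradedPart I k
  rw [h] at h1
  omega

/-- Hilbert's theorem, by Noetherian induction: if some `x_i ∉ I` has `I : x_i ≠ I`, the Hilbert
function of `I` is a sum of those of two larger ideals; if `I : x_i = I`, its first difference is
the Hilbert function of a larger ideal. -/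
theorem exists_isHilbertPolynomial (I : Ideal (MvPolynomial (Fin n) K))
    (hI : ∀ f ∈ I, ∀ k, homogeneousComponent k f ∈ I) : ∃ P, IsHilbertPolynomial I P := by
  induction I using WellFoundedGT.induction with
  | ind I ih =>
  by_cases hX : ∀ i, X i ∈ I
  · refine ⟨0, Filter.eventually_atTop.2 ⟨1, fun k hk => ?_⟩⟩
    rw [hilbertFunction_eq_zero_of_X_mem hX hk]
    simp
  push Not at hX
  obtain ⟨i, hi⟩ := hX
  have hlt : I < I ⊔ Ideal.span {X i} :=
    left_lt_sup.2 fun h => hi (h (Ideal.mem_span_singleton_self _))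
  obtain ⟨P, hP⟩ := ih _ hlt (homogeneousComponent_mem_sup_span_X hI i)
  have hP' : ∀ᶠ k : ℕ in Filter.atTop,
      P.eval ((k : ℚ) + 1) = hilbertFunction (I ⊔ Ideal.span {X i}) (k + 1) := by
    have := (Filter.tendsto_add_atTop_nat 1).eventually hP
    simpa using this
  rcases (le_colonX I i).eq_or_lt with he | hc
  · refine exists_polynomial_of_difference (P := P.comp (Polynomial.X + 1)) ?_
    filter_upwards [hP'] with k hk
    have := hilbertFunction_succ hI i k
    rw [← he] at this
    rw [this]
    push_cast
    simpa using hk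
  · obtain ⟨Q, hQ⟩ := ih _ hc (homogeneousComponent_mem_colonX hI i)
    refine ⟨P + Q.comp (Polynomial.X - 1), ?_⟩
    have : ∀ᶠ k : ℕ in Filter.atTop, (P + Q.comp (Polynomial.X - 1)).eval (((k + 1 : ℕ) : ℚ)) =
        hilbertFunction I (k + 1) := by
      filter_upwards [hP', hQ] with k h1 h2
      rw [hilbertFunction_succ hI i k]
      push_cast
      simp [h1, h2, add_comm]
    rw [IsHilbertPolynomial, ← Filter.map_add_atTop_eq_nat 1]
    exact this

end HilbertPolynomial

/-! ### The degree of a homogeneous ideal -/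

section Degree

theorem leadingCoeff_nonneg_of_eventually {P : Polynomial ℚ}
    (h : ∀ᶠ k : ℕ in Filter.atTop, 0 ≤ P.eval (k : ℚ)) : 0 ≤ P.leadingCoeff := by
  by_contra! hneg
  rcases lt_or_ge 0 P.degree with hd | hd
  · have ht := (P.tendsto_atBot_of_leadingCoeff_nonpos hd hneg.le).comp
      tendsto_natCast_atTop_atTop
    obtain ⟨k, h1, h2⟩ := (h.and (ht.eventually (Filter.eventually_lt_atBot 0))).exists
    exact absurd h1 (not_le.2 h2)
  · obtain ⟨k, h1⟩ := h.exists
    rw [Polynomial.eq_C_of_degree_le_zero hd] at h1 hneg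
    rw [Polynomial.leadingCoeff_C] at hneg
    rw [Polynomial.eval_C] at h1
    exact absurd h1 (not_le.2 hneg)

theorem natDegree_le_of_eventually_le {P : Polynomial ℚ} {m : ℕ} {c : ℚ}
    (h0 : ∀ᶠ k : ℕ in Filter.atTop, 0 ≤ P.eval (k : ℚ))
    (h : ∀ᶠ k : ℕ in Filter.atTop, P.eval (k : ℚ) ≤ c * ((k : ℚ) + 1) ^ m) :
    P.natDegree ≤ m := by
  by_contra! hm
  have hP : 0 < P.leadingCoeff := lt_of_le_of_ne (leadingCoeff_nonneg_of_eventually h0)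
    (Ne.symm (Polynomial.leadingCoeff_ne_zero.2 (by rintro rfl; simp at hm)))
  have hQ : (Polynomial.C c * (Polynomial.X + 1) ^ m).degree < P.degree := by
    refine Polynomial.degree_lt_degree (lt_of_le_of_lt ?_ hm)
    refine (Polynomial.natDegree_C_mul_le _ _).trans ((Polynomial.natDegree_pow_le).trans ?_)
    have : (Polynomial.X + 1 : Polynomial ℚ).natDegree = 1 := Polynomial.natDegree_X_add_C 1
    rw [this, mul_one]
  have h1 := leadingCoeff_nonneg_of_eventually (P := Polynomial.C c * (Polynomial.X + 1) ^ m - P)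
    (by filter_upwards [h] with k hk; simpa using hk)
  rw [Polynomial.leadingCoeff_sub_of_degree_lt' hQ] at h1
  linarith

/-- A polynomial with integer values at large integers has an integer normalized leading
coefficient. -/
theorem exists_int_eq_factorial_mul_leadingCoeff {P : Polynomial ℚ} {f : ℕ → ℕ}
    (h : ∀ᶠ k : ℕ in Filter.atTop, P.eval (k : ℚ) = f k) :
    ∃ D : ℤ, (D : ℚ) = (P.natDegree.factorial : ℚ) * P.leadingCoeff := by
  obtain ⟨N, hN⟩ := Filter.eventually_atTop.1 h
  have h1 := congrFun P.fwdDiff_iter_degree_eq_factorial (N : ℚ)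
  rw [fwdDiff_iter_eq_sum_shift] at h1
  -- the iterated difference of order `natDegree P` of integer values
  refine ⟨∑ k ∈ Finset.range (P.natDegree + 1),
    ((-1 : ℤ) ^ (P.natDegree - k) * P.natDegree.choose k) * f (N + k), ?_⟩
  push_cast
  have h2 : (P.natDegree.factorial : ℚ) * P.leadingCoeff =
    (P.leadingCoeff • ((P.natDegree.factorial : ℚ → ℚ))) (N : ℚ) := by
    simp [mul_comm]
  rw [h2, ← h1]
  refine Finset.sum_congr rfl fun k _ => ?_
  have := hN (N + k) (Nat.le_add_right _ _)
  rw [← this]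
  simp

variable {K : Type*} [Field K] {n : ℕ}

/-- A homogeneous ideal whose Hilbert function grows like a polynomial of degree `m`, and is at
least `N * k ^ m / m! + ⋯`, has degree at least `N`. -/
theorem exists_hasDegree_of_hilbertFunction_bounds {I : Ideal (MvPolynomial (Fin n) K)}
    (hI : ∀ f ∈ I, ∀ k, homogeneousComponent k f ∈ I) {N m : ℕ} {c : ℚ} (hN : 0 < N)
    (hlow : ∀ k, m < k → N * (k - 1).choose m ≤ hilbertFunction I k)
    (hup : ∀ k, (hilbertFunction I k : ℚ) ≤ c * ((k : ℚ) + 1) ^ m) :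
    ∃ D : ℕ, HasDegree I D ∧ N ≤ D := by
  obtain ⟨P, hP⟩ := exists_isHilbertPolynomial I hI
  have hP0 : ∀ᶠ k : ℕ in Filter.atTop, 0 ≤ P.eval (k : ℚ) := by
    filter_upwards [hP] with k hk
    rw [hk]
    positivity
  have hdeg : P.natDegree ≤ m := natDegree_le_of_eventually_le (c := c) hP0 (by
    filter_upwards [hP] with k hk
    rw [hk]
    exact hup k)
  have hlead : (N : ℚ) * (m.factorial : ℚ)⁻¹ ≤ P.coeff m := by
    -- `R` takes the value `choose (k - 1) m` at `k > m`
    set R := Polynomial.preHilbertPoly ℚ m (m + 1) with hR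
    have h1 := leadingCoeff_nonneg_of_eventually (P := P - Polynomial.C (N : ℚ) * R) (by
      filter_upwards [hP, Filter.eventually_ge_atTop (m + 1)] with k hk hmk
      rw [Polynomial.eval_sub, Polynomial.eval_mul, Polynomial.eval_C, hk, hR,
        Polynomial.preHilbertPoly_eq_choose_sub_add ℚ m hmk, sub_nonneg,
        show k - (m + 1) + m = k - 1 by omega]
      exact_mod_cast hlow k hmk)
    have h2 : (P - Polynomial.C (N : ℚ) * R).coeff m =
        P.coeff m - N * (m.factorial : ℚ)⁻¹ := by
      rw [Polynomial.coeff_sub, Polynomial.coeff_C_mul, hR, Polynomial.coeff_preHilbertPoly_self]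
    have h3 : (P - Polynomial.C (N : ℚ) * R).natDegree ≤ m :=
      (Polynomial.natDegree_sub_le_of_le hdeg ((Polynomial.natDegree_C_mul_le _ _).trans
        (Polynomial.natDegree_preHilbertPoly ℚ m (m + 1)).le)).trans (max_self m).le
    rw [← sub_nonneg, ← h2]
    rcases h3.eq_or_lt with h4 | h4
    · rwa [Polynomial.leadingCoeff, h4] at h1
    · rw [Polynomial.coeff_eq_zero_of_natDegree_lt h4]
  have hfac : (0 : ℚ) < m.factorial := by exact_mod_cast m.factorial_pos
  have hcpos : 0 < P.coeff m := lt_of_lt_of_le (by positivity) hlead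
  have hdeg' : P.natDegree = m :=
    le_antisymm hdeg (Polynomial.le_natDegree_of_ne_zero hcpos.ne')
  obtain ⟨D, hD⟩ := exists_int_eq_factorial_mul_leadingCoeff hP
  have hND : (N : ℚ) ≤ D := by
    rw [hD, Polynomial.leadingCoeff, hdeg']
    have := mul_le_mul_of_nonneg_left hlead hfac.le
    rwa [mul_left_comm, mul_inv_cancel₀ hfac.ne', mul_one] at this
  have hND' : (N : ℤ) ≤ D := by exact_mod_cast hND
  lift D to ℕ using (by omega)
  refine ⟨D, ⟨P, hP, ?_, by exact_mod_cast hD⟩, by exact_mod_cast hND'⟩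
  rintro rfl
  simp at hcpos

end Degree

/-! ### Krull dimension and transcendence degree -/

section KrullDimension

theorem ringKrullDim_eq_of_isIntegral {R S : Type*} [CommRing R] [CommRing S] [Algebra R S]
    [Algebra.IsIntegral R S] (hinj : Function.Injective (algebraMap R S)) :
    ringKrullDim S = ringKrullDim R := by
  apply le_antisymm
  · refine Order.krullDim_le_of_strictMono (PrimeSpectrum.comap (algebraMap R S)) ?_
    intro P Q hPQ
    exact Ideal.IsIntegral.comap_lt_comap hPQ
  · refine iSup_le fun l => ?_
    have : FaithfulSMul R S := (faithfulSMul_iff_algebraMap_injective R S).2 hinj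
    obtain ⟨Q, hQ⟩ := Algebra.IsIntegral.comap_surjective R S l.head
    have : Q.asIdeal.LiesOver l.head.asIdeal := ⟨by rw [← hQ]; rfl⟩
    obtain ⟨L, hL, -⟩ := Ideal.exists_ltSeries_of_hasGoingUp l Q.asIdeal
    rw [← hL]
    exact Order.LTSeries.length_le_krullDim L

theorem ringKrullDim_eq_of_trdeg_eq (K A : Type*) [Field K] [CommRing A] [IsDomain A] [Algebra K A]
    [Algebra.FiniteType K A] {m : ℕ} (hm : Algebra.trdeg K A = m) :
    ringKrullDim A = (m : WithBot ℕ∞) := by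
  obtain ⟨s, g, hg, hint⟩ := exists_integral_inj_algHom_of_fg K A
  algebraize [g.toRingHom]
  have : IsScalarTower K (MvPolynomial (Fin s) K) A :=
    IsScalarTower.of_algebraMap_eq fun x => (g.commutes x).symm
  have hA : Algebra.IsIntegral (MvPolynomial (Fin s) K) A := ⟨hint⟩
  have hinj : Function.Injective (algebraMap (MvPolynomial (Fin s) K) A) := hg
  have : FaithfulSMul (MvPolynomial (Fin s) K) A :=
    (faithfulSMul_iff_algebraMap_injective _ _).2 hinj
  have h1 := lift_trdeg_add_eq K (MvPolynomial (Fin s) K) A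
  rw [trdeg_eq_zero (R := MvPolynomial (Fin s) K), MvPolynomial.trdeg_of_isDomain, hm] at h1
  have hs : s = m := by
    simp at h1
    exact_mod_cast h1
  rw [ringKrullDim_eq_of_isIntegral hinj, MvPolynomial.ringKrullDim_of_isNoetherianRing, hs]
  simp

end KrullDimension

/-! ### The secant ideal of a toric ideal as a kernel -/

section Parametrization

variable {K : Type*} [Field K] {n d : ℕ}

/-- The parametrization `x_i ↦ t_1^(a i) + ⋯ + t_r^(a i)` of the `r`-th secant variety of a toric
variety, with values in the Laurent polynomials in `r` vectors of unknowns `t_j`. A Laurent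
monomial is recorded by its `r` exponent vectors. -/
noncomputable def secantParam (K : Type*) [Field K] (a : Fin n → Fin d → ℤ) (r : ℕ) :
    MvPolynomial (Fin n) K →ₐ[K] AddMonoidAlgebra K (Fin r → Fin d → ℤ) :=
  aeval fun i => ∑ j : Fin r, AddMonoidAlgebra.single (Pi.single j (a i)) 1

/-- The parametrization `y_(j, i) ↦ t_j^(a i)` of the product of `r` copies of the affine cone over
a toric variety. -/
noncomputable def prodParam (K : Type*) [Field K] (a : Fin n → Fin d → ℤ) (r : ℕ) :
    MvPolynomial (Fin r × Fin n) K →ₐ[K] AddMonoidAlgebra K (Fin r → Fin d → ℤ) :=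
  aeval fun p => AddMonoidAlgebra.single (Pi.single p.1 (a p.2)) 1

/-- The exponent of the Laurent monomial `prodParam K a r (monomial u 1)`. -/
def prodExponent (a : Fin n → Fin d → ℤ) {r : ℕ} (u : Fin r × Fin n →₀ ℕ) : Fin r → Fin d → ℤ :=
  fun j => ∑ i, u (j, i) • a i

theorem aeval_single_monomial {σ M : Type*} [Fintype σ] [AddCommMonoid M] (b : σ → M)
    (u : σ →₀ ℕ) (c : K) :
    aeval (fun i => (AddMonoidAlgebra.single (b i) 1 : AddMonoidAlgebra K M)) (monomial u c) =
      AddMonoidAlgebra.single (∑ i, u i • b i) c := by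
  rw [aeval_monomial, Finsupp.prod_fintype _ _ (fun i => pow_zero _)]
  simp_rw [AddMonoidAlgebra.single_pow, one_pow]
  rw [AddMonoidAlgebra.prod_single, Finset.prod_const_one,
    AddMonoidAlgebra.coe_algebraMap, Function.comp_apply, AddMonoidAlgebra.single_mul_single]
  simp

theorem prodParam_monomial (a : Fin n → Fin d → ℤ) {r : ℕ} (u : Fin r × Fin n →₀ ℕ) (c : K) :
    prodParam K a r (monomial u c) = AddMonoidAlgebra.single (prodExponent a u) c := by
  rw [prodParam, aeval_single_monomial]
  congr 1
  ext j k
  simp only [prodExponent, Fintype.sum_prod_type, Finset.sum_apply]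
  rw [Finset.sum_eq_single j]
  · simp
  · intro j' _ hj'
    simp [Pi.single_eq_of_ne hj'.symm]
  · simp

theorem monomial_sub_monomial_mem_toricIdeal {a : Fin n → Fin d → ℤ} {u v : Fin n →₀ ℕ}
    (h : ∑ i, u i • a i = ∑ i, v i • a i) : monomial u 1 - monomial v 1 ∈ toricIdeal K a := by
  rw [toricIdeal, RingHom.mem_ker, map_sub]
  erw [aeval_single_monomial, aeval_single_monomial]
  rw [h, sub_self]

/-- The sum `I(y_1) + ⋯ + I(y_r)` for the toric ideal `I`. -/
noncomputable def toricIdealSum (K : Type*) [Field K] (a : Fin n → Fin d → ℤ) (r : ℕ) :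
    Ideal (MvPolynomial (Fin r × Fin n) K) :=
  ⨆ j : Fin r, (toricIdeal K a).map (rename (fun i => (j, i)) :
    MvPolynomial (Fin n) K →ₐ[K] MvPolynomial (Fin r × Fin n) K)

theorem monomial_sub_monomial_mem_toricIdealSum {a : Fin n → Fin d → ℤ} {r : ℕ}
    {u v : Fin r × Fin n →₀ ℕ} (h : prodExponent a u = prodExponent a v) :
    monomial u 1 - monomial v 1 ∈ toricIdealSum K a r := by
  have hprod : ∀ w : Fin r × Fin n →₀ ℕ, (monomial w 1 : MvPolynomial (Fin r × Fin n) K) =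
      ∏ j, rename (fun i => (j, i))
        (monomial (Finsupp.equivFunOnFinite.symm fun i => w (j, i)) 1) := by
    intro w
    simp_rw [monomial_eq, map_mul, rename_C, C_1, one_mul]
    rw [Finsupp.prod_fintype _ _ (fun i => pow_zero _), Fintype.prod_prod_type]
    refine Finset.prod_congr rfl fun j _ => ?_
    rw [Finsupp.prod_fintype _ _ (fun i => pow_zero _), map_prod]
    simp
  rw [← Ideal.Quotient.eq, hprod u, hprod v, map_prod, map_prod]
  refine Finset.prod_congr rfl fun j _ => ?_
  rw [Ideal.Quotient.eq, ← map_sub]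
  refine Ideal.mem_iSup_of_mem j (Ideal.mem_map_of_mem _ ?_)
  exact monomial_sub_monomial_mem_toricIdeal (congrFun h j)

/-- Modulo `I(y_1) + ⋯ + I(y_r)` a monomial depends on its image only, so that `prodParam` has a
linear inverse there. -/
theorem mem_toricIdealSum_of_prodParam_eq_zero {a : Fin n → Fin d → ℤ} {r : ℕ}
    {g : MvPolynomial (Fin r × Fin n) K} (hg : prodParam K a r g = 0) :
    g ∈ toricIdealSum K a r := by
  let T : ((Fin r → Fin d → ℤ) →₀ K) →ₗ[K] _ := Finsupp.linearCombination K fun m =>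
    Ideal.Quotient.mkₐ K (toricIdealSum K a r) (monomial (Function.invFun (prodExponent a) m) 1)
  have hT : ∀ f, T (prodParam K a r f).coeff = Ideal.Quotient.mkₐ K (toricIdealSum K a r) f := by
    intro f
    induction f using MvPolynomial.induction_on' with
    | monomial u c =>
      rw [prodParam_monomial, AddMonoidAlgebra.coeff_single, Finsupp.linearCombination_single,
        ← map_smul, Ideal.Quotient.mkₐ_eq_mk, Ideal.Quotient.eq]
      have := monomial_sub_monomial_mem_toricIdealSum (K := K)
        (Function.invFun_eq (f := prodExponent a) ⟨u, rfl⟩)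
      have h2 := (toricIdealSum K a r).mul_mem_left (C c) this
      rw [mul_sub, C_mul_monomial, C_mul_monomial, mul_one] at h2
      rwa [smul_monomial, smul_eq_mul, mul_one]
    | add p q hp hq => rw [map_add, map_add, AddMonoidAlgebra.coeff_add, map_add, hp, hq]
  have := hT g
  rw [hg, AddMonoidAlgebra.coeff_zero, map_zero, Ideal.Quotient.mkₐ_eq_mk] at this
  exact Ideal.Quotient.eq_zero_iff_mem.1 this.symm

theorem secantIdeal_toricIdeal (a : Fin n → Fin d → ℤ) (r : ℕ) :
    secantIdeal (toricIdeal K a) r = RingHom.ker (secantParam K a r) := by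
  apply le_antisymm
  · intro f hf
    let Φ : MvPolynomial (Fin n ⊕ Fin r × Fin n) K →ₐ[K] AddMonoidAlgebra K (Fin r → Fin d → ℤ) :=
      aeval (Sum.elim (fun i => ∑ j : Fin r, AddMonoidAlgebra.single (Pi.single j (a i)) 1)
        (fun p => AddMonoidAlgebra.single (Pi.single p.1 (a p.2)) 1))
    have hΦ : Φ (rename Sum.inl f) = 0 := by
      refine (show _ ≤ RingHom.ker Φ from ?_) (Ideal.mem_comap.1 hf)
      refine sup_le (iSup_le fun j => Ideal.map_le_iff_le_comap.2 fun g hg => ?_)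
        (Ideal.span_le.2 ?_)
      · rw [Ideal.mem_comap, RingHom.mem_ker]
        let θ : AddMonoidAlgebra K (Fin d → ℤ) →ₐ[K] AddMonoidAlgebra K (Fin r → Fin d → ℤ) :=
          AddMonoidAlgebra.mapDomainAlgHom K K (AddMonoidHom.single (fun _ => Fin d → ℤ) j)
        have : ∀ g, Φ (rename (fun i => Sum.inr (j, i)) g) = θ (aeval (fun i =>
            (AddMonoidAlgebra.single (a i) 1 : AddMonoidAlgebra K (Fin d → ℤ))) g) := by
          intro g
          rw [← AlgHom.comp_apply, ← AlgHom.comp_apply]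
          congr 1
          ext i : 1
          simp [Φ, θ]
        rw [this]
        have hg' : aeval (fun i =>
            (AddMonoidAlgebra.single (a i) 1 : AddMonoidAlgebra K (Fin d → ℤ))) g = 0 := hg
        rw [hg', map_zero]
      · rintro _ ⟨i, rfl⟩
        simp [Φ, RingHom.mem_ker]
    rw [RingHom.mem_ker, ← hΦ]
    simp [Φ, secantParam, aeval_rename, Function.comp_def]
  · intro f hf
    let ψ : MvPolynomial (Fin n) K →ₐ[K] MvPolynomial (Fin r × Fin n) K :=
      aeval fun i => ∑ j, X (j, i)
    have hψ : prodParam K a r (ψ f) = 0 := by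
      rw [← RingHom.mem_ker.1 hf, ← AlgHom.comp_apply]
      congr 1
      ext i : 1
      simp [ψ, prodParam, secantParam]
    have hmem := Ideal.mem_map_of_mem (rename Sum.inr :
      MvPolynomial (Fin r × Fin n) K →ₐ[K] MvPolynomial (Fin n ⊕ Fin r × Fin n) K)
      (mem_toricIdealSum_of_prodParam_eq_zero hψ)
    have hsum : (toricIdealSum K a r).map (rename Sum.inr :
        MvPolynomial (Fin r × Fin n) K →ₐ[K] MvPolynomial (Fin n ⊕ Fin r × Fin n) K) =
        ⨆ j, (toricIdeal K a).map (rename (fun i => Sum.inr (j, i)) :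
          MvPolynomial (Fin n) K →ₐ[K] MvPolynomial (Fin n ⊕ Fin r × Fin n) K) := by
      rw [toricIdealSum, Ideal.map_iSup]
      congr 1
      ext1 j
      rw [Ideal.map_mapₐ]
      congr 1
      ext i : 1
      simp
    rw [hsum] at hmem
    rw [secantIdeal, idealJoin, Ideal.mem_comap]
    set J := (⨆ j, (toricIdeal K a).map (rename (fun i => Sum.inr (j, i)) :
        MvPolynomial (Fin n) K →ₐ[K] MvPolynomial (Fin n ⊕ Fin r × Fin n) K)) ⊔
      Ideal.span (Set.range fun i : Fin n =>
        (∑ j : Fin r, X (Sum.inr (j, i))) - X (Sum.inl i)) with hJ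
    have heq : Ideal.Quotient.mkₐ K J (rename Sum.inr (ψ f)) =
        Ideal.Quotient.mkₐ K J (rename Sum.inl f) := by
      rw [← AlgHom.comp_apply, ← AlgHom.comp_apply, ← AlgHom.comp_apply]
      congr 1
      ext i : 1
      simp only [ψ, AlgHom.comp_apply, aeval_X, map_sum, rename_X]
      rw [← map_sum, Ideal.Quotient.mkₐ_eq_mk, Ideal.Quotient.eq]
      exact Ideal.mem_sup_right (Ideal.subset_span ⟨i, rfl⟩)
    rw [Ideal.Quotient.mkₐ_eq_mk, Ideal.Quotient.eq] at heq
    have := J.sub_mem (Ideal.mem_sup_left hmem) heq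
    rwa [sub_sub_cancel] at this

end Parametrization

/-! ### Maximal cells of a regular triangulation -/

section Cells

variable {n d : ℕ} {a : Fin n → Fin d → ℤ}

theorem eq_zero_of_forall_sum_mul_eq_zero
    (hrank : Submodule.span ℚ (Set.range fun i => fun k => (a i k : ℚ)) = ⊤) {u : Fin d → ℝ}
    (hu : ∀ i, ∑ k, u k * (a i k : ℝ) = 0) : u = 0 := by
  let f : (Fin d → ℚ) →ₗ[ℚ] ℝ := ∑ k, (LinearMap.proj k).smulRight (u k)
  have hf : ∀ x, f x = ∑ k, (x k : ℝ) * u k := by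
    intro x
    simp [f, LinearMap.sum_apply, Rat.smul_def]
  have hle : Submodule.span ℚ (Set.range fun i => fun k => (a i k : ℚ)) ≤ LinearMap.ker f := by
    rw [Submodule.span_le]
    rintro _ ⟨i, rfl⟩
    rw [SetLike.mem_coe, LinearMap.mem_ker, hf, ← hu i]
    exact Finset.sum_congr rfl fun k _ => by push_cast; ring
  funext k
  have := hle (hrank ▸ Submodule.mem_top : Pi.single k (1 : ℚ) ∈ _)
  rw [LinearMap.mem_ker, hf, Finset.sum_eq_single k] at this
  · simpa using this
  · intro j _ hj
    simp [Pi.single_eq_of_ne hj]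
  · simp

/-- Tilting the supporting functional of a cell along a functional that vanishes on the cell and is
positive somewhere, until it first meets another lifted point, enlarges the cell. -/
theorem IsRegularCell.exists_ssuperset {w : Fin n → ℝ} {σ : Finset (Fin n)}
    (hσ : IsRegularCell a w σ) {u : Fin d → ℝ} (hu : ∀ i ∈ σ, ∑ k, u k * (a i k : ℝ) = 0)
    (hpos : ∃ i, 0 < ∑ k, u k * (a i k : ℝ)) : ∃ τ, IsRegularCell a w τ ∧ σ ⊂ τ := by
  classical
  obtain ⟨c, hc, hc'⟩ := hσ
  set L : Fin n → ℝ := fun i => ∑ k, u k * (a i k : ℝ) with hL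
  set s : Fin n → ℝ := fun i => w i - ∑ k, c k * (a i k : ℝ) with hs
  obtain ⟨i₀, hi₀, hmin⟩ := Finset.exists_min_image (Finset.univ.filter fun i => 0 < L i)
    (fun i => s i / L i) (by obtain ⟨i, hi⟩ := hpos; exact ⟨i, by simpa using hi⟩)
  have hLi₀ : 0 < L i₀ := (Finset.mem_filter.1 hi₀).2
  have hi₀σ : i₀ ∉ σ := fun h => hLi₀.ne' (hu i₀ h)
  set t := s i₀ / L i₀ with ht
  have ht0 : 0 < t := div_pos (sub_pos.2 (hc' i₀ hi₀σ)) hLi₀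
  have hval : ∀ i, ∑ k, (c k + t * u k) * (a i k : ℝ) = w i - s i + t * L i := by
    intro i
    simp only [hs, hL, sub_sub_cancel, Finset.mul_sum, ← Finset.sum_add_distrib]
    exact Finset.sum_congr rfl fun k _ => by ring
  have hle : ∀ i, ∑ k, (c k + t * u k) * (a i k : ℝ) ≤ w i := by
    intro i
    rw [hval]
    by_cases hLi : 0 < L i
    · have := hmin i (Finset.mem_filter.2 ⟨Finset.mem_univ _, hLi⟩)
      rw [le_div_iff₀ hLi] at this
      linarith
    · have h1 : 0 ≤ s i := by
        by_cases hi : i ∈ σ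
        · exact (sub_eq_zero.2 (hc i hi).symm).ge
        · exact (sub_pos.2 (hc' i hi)).le
      have := mul_nonpos_of_nonneg_of_nonpos ht0.le (not_lt.1 hLi)
      linarith
  refine ⟨Finset.univ.filter fun i => ∑ k, (c k + t * u k) * (a i k : ℝ) = w i,
    ⟨fun k => c k + t * u k, fun i hi => (Finset.mem_filter.1 hi).2, fun i hi =>
      lt_of_le_of_ne (hle i) fun h => hi (Finset.mem_filter.2 ⟨Finset.mem_univ _, h⟩)⟩, ?_⟩
  rw [Finset.ssubset_iff_of_subset]
  · refine ⟨i₀, Finset.mem_filter.2 ⟨Finset.mem_univ _, ?_⟩, hi₀σ⟩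
    rw [hval, ht, div_mul_cancel₀ _ hLi₀.ne']
    ring
  · intro i hi
    refine Finset.mem_filter.2 ⟨Finset.mem_univ _, ?_⟩
    have h1 : s i = 0 := sub_eq_zero.2 (hc i hi).symm
    have h2 : L i = 0 := hu i hi
    rw [hval, h1, h2]
    ring

theorem card_eq_of_maximal
    (hrank : Submodule.span ℚ (Set.range fun i => fun k => (a i k : ℚ)) = ⊤)
    {Δ : Set (Finset (Fin n))} (hΔ : IsRegularTriangulation a Δ) {σ : Finset (Fin n)}
    (hσ : Maximal (· ∈ Δ) σ) : σ.card = d := by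
  obtain ⟨w, hw, hind⟩ := hΔ
  have hli := hind σ hσ.prop
  have hspan : Submodule.span ℝ (Set.range fun i : σ => fun k => (a i k : ℝ)) = ⊤ := by
    by_contra hne
    -- a functional that vanishes on the cell, and not on all points, contradicts maximality
    obtain ⟨f, hf0, hf⟩ := Submodule.exists_le_ker_of_lt_top _ (lt_top_iff_ne_top.2 hne)
    have hfu : ∀ x : Fin d → ℝ, f x = ∑ k, f (Pi.single k 1) * x k := by
      intro x
      conv_lhs => rw [pi_eq_sum_univ' x]
      rw [map_sum]
      refine Finset.sum_congr rfl fun k _ => ?_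
      rw [map_smul, smul_eq_mul, mul_comm]
    set u : Fin d → ℝ := fun k => f (Pi.single k 1) with hu
    have huσ : ∀ i ∈ σ, ∑ k, u k * (a i k : ℝ) = 0 := fun i hi => by
      have := hf (Submodule.subset_span ⟨⟨i, hi⟩, rfl⟩)
      rwa [LinearMap.mem_ker, hfu] at this
    have hex : ∃ i, ∑ k, u k * (a i k : ℝ) ≠ 0 := by
      by_contra! h
      have h0 := eq_zero_of_forall_sum_mul_eq_zero hrank h
      refine hf0 (LinearMap.ext fun x => ?_)
      rw [hfu]
      simp [show ∀ k, f (Pi.single k 1) = 0 from fun k => congrFun h0 k]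
    obtain ⟨i, hi⟩ := hex
    have hcell := (hw σ).1 hσ.prop
    obtain ⟨τ, hτ, hστ⟩ : ∃ τ, IsRegularCell a w τ ∧ σ ⊂ τ := by
      rcases lt_or_gt_of_ne hi with hneg | hpos
      · refine hcell.exists_ssuperset (u := -u) (fun i hi => ?_) ⟨i, ?_⟩
        · simpa using huσ i hi
        · simpa using hneg
      · exact hcell.exists_ssuperset huσ ⟨i, hpos⟩
    exact hστ.2 (hσ.le_of_ge ((hw τ).2 hτ) hστ.1)
  have := Module.finrank_eq_card_basis (Module.Basis.mk hli hspan.ge)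
  simpa using this.symm

theorem IsPartitionable.card_eq
    (hrank : Submodule.span ℚ (Set.range fun i => fun k => (a i k : ℚ)) = ⊤)
    {Δ : Set (Finset (Fin n))} (hΔ : IsRegularTriangulation a Δ) {r : ℕ} {C : Finset (Fin n)}
    (hC : IsPartitionable Δ r C) : C.card = r * d := by
  obtain ⟨σ, hσ, hdisj, rfl⟩ := hC
  rw [Finset.card_biUnion fun i _ j _ hij => hdisj i j hij,
    Finset.sum_congr rfl fun j _ => card_eq_of_maximal hrank hΔ (hσ j)]
  simp

end Cells

/-! ### Leading terms of the parametrization -/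

section LeadingTerm

variable {K : Type*} [Field K] {n d r : ℕ} {a : Fin n → Fin d → ℤ}

theorem coeff_secantParam_monomial_add_single (u : Fin n →₀ ℕ) (i : Fin n)
    (m : Fin r → Fin d → ℤ) :
    (secantParam K a r (monomial (u + Finsupp.single i 1) 1)).coeff m =
      ∑ j, (secantParam K a r (monomial u 1)).coeff (m - Pi.single j (a i)) := by
  rw [monomial_add_single, pow_one, map_mul, secantParam, aeval_X, Finset.mul_sum,
    AddMonoidAlgebra.coeff_sum, Finsupp.finsetSum_apply]
  refine Finset.sum_congr rfl fun j _ => ?_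
  rw [AddMonoidAlgebra.coeff_mul_single_apply, mul_one, sub_eq_add_neg]

theorem coeff_secantParam_monomial_zero (m : Fin r → Fin d → ℤ) :
    (secantParam K a r (monomial 0 1)).coeff m = if m = 0 then 1 else 0 := by
  classical
  rw [monomial_zero', C_1, map_one, AddMonoidAlgebra.one_def, AddMonoidAlgebra.coeff_single,
    Finsupp.single_apply]
  simp [eq_comm]

theorem coeff_secantParam (f : MvPolynomial (Fin n) K) (m : Fin r → Fin d → ℤ) :
    (secantParam K a r f).coeff m =
      ∑ u ∈ f.support, f.coeff u * (secantParam K a r (monomial u 1)).coeff m := by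
  conv_lhs => rw [f.as_sum]
  rw [map_sum, AddMonoidAlgebra.coeff_sum, Finsupp.finsetSum_apply]
  refine Finset.sum_congr rfl fun u _ => ?_
  rw [show monomial u (f.coeff u) = f.coeff u • monomial u (1 : K) by
    rw [smul_monomial, smul_eq_mul, mul_one], map_smul, AddMonoidAlgebra.coeff_smul_apply,
    smul_eq_mul]

/-- The exponent of the Laurent monomial obtained from `x^u` by `x_i ↦ t_j^(a i)` for `i ∈ σ j`
(for pairwise disjoint `σ j` that cover the support of `u`). -/
def leadExponent (a : Fin n → Fin d → ℤ) (σ : Fin r → Finset (Fin n)) (u : Fin n →₀ ℕ) :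
    Fin r → Fin d → ℤ :=
  fun j => ∑ i ∈ σ j, u i • a i

theorem leadExponent_add_single {σ : Fin r → Finset (Fin n)}
    (hσ : ∀ i j, i ≠ j → Disjoint (σ i) (σ j)) {i : Fin n} {j : Fin r} (hi : i ∈ σ j)
    (u : Fin n →₀ ℕ) :
    leadExponent a σ (u + Finsupp.single i 1) = leadExponent a σ u + Pi.single j (a i) := by
  classical
  funext j'
  have h : leadExponent a σ (u + Finsupp.single i 1) j' =
      leadExponent a σ u j' + if i ∈ σ j' then a i else 0 := by
    simp only [leadExponent, Finsupp.add_apply, add_smul, Finset.sum_add_distrib]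
    congr 1
    simp [Finsupp.single_apply, ite_smul]
  rw [h, Pi.add_apply]
  by_cases hj : j' = j
  · subst hj
    simp [hi]
  · rw [if_neg fun h' => Finset.disjoint_left.1 (hσ j' j hj) h' hi, Pi.single_eq_of_ne hj]

theorem weight_leadExponent {σ : Fin r → Finset (Fin n)}
    (hσ : ∀ i j, i ≠ j → Disjoint (σ i) (σ j)) {w : Fin n → ℝ} {V : (Fin r → Fin d → ℤ) →+ ℝ}
    (hV : ∀ j, ∀ i ∈ σ j, V (Pi.single j (a i)) = w i) {u : Fin n →₀ ℕ}
    (hu : ∀ i, u i ≠ 0 → ∃ j, i ∈ σ j) : V (leadExponent a σ u) = ∑ i, u i • w i := by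
  classical
  have h1 : leadExponent a σ u = ∑ j, ∑ i ∈ σ j, u i • Pi.single j (a i) := by
    funext j
    rw [Finset.sum_apply, Finset.sum_eq_single j]
    · simp [leadExponent]
    · intro j' _ hj'
      rw [Finset.sum_apply]
      exact Finset.sum_eq_zero fun i _ => by simp [Pi.single_eq_of_ne hj'.symm]
    · simp
  rw [h1, map_sum]
  simp_rw [map_sum, map_nsmul]
  rw [Finset.sum_congr rfl fun j _ => Finset.sum_congr rfl fun i hi => by rw [hV j i hi],
    ← Finset.sum_biUnion fun i _ j _ hij => hσ i j hij]
  refine Finset.sum_subset (Finset.subset_univ _) fun i _ hi => ?_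
  have : u i = 0 := by
    by_contra h
    obtain ⟨j, hj⟩ := hu i h
    exact hi (Finset.mem_biUnion.2 ⟨j, Finset.mem_univ _, hj⟩)
  rw [this, zero_smul]

theorem exponent_induction {σ : Type*} {motive : (σ →₀ ℕ) → Prop} (zero : motive 0)
    (add_single : ∀ u i, motive u → motive (u + Finsupp.single i 1)) (u : σ →₀ ℕ) : motive u := by
  induction u using Finsupp.induction₂ with
  | zero => exact zero
  | add_single i k u _ _ hu =>
    clear * - hu add_single
    induction k with
    | zero => simpa using hu
    | succ k ih =>
      rw [Finsupp.single_add, ← add_assoc]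
      exact add_single _ _ ih

theorem sum_add_single_smul {M : Type*} [AddCommMonoid M] (w : Fin n → M) (u : Fin n →₀ ℕ)
    (i : Fin n) : ∑ l, (u + Finsupp.single i 1 : Fin n →₀ ℕ) l • w l = ∑ l, u l • w l + w i := by
  simp only [Finsupp.add_apply, add_smul, Finset.sum_add_distrib]
  congr 1
  simp [Finsupp.single_apply, ite_smul]

open Classical in
/-- Let the weight `V` of `t_j^(a i)` be at most `w i`, with equality exactly for `i ∈ σ j`. Then
the terms of weight at least `w · u` in the image of `x^u` are: one monomial of weight `w · u` if
`u` is supported on the union of the `σ j`, and none otherwise. -/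
theorem coeff_secantParam_monomial_of_weight_le {σ : Fin r → Finset (Fin n)}
    (hσ : ∀ i j, i ≠ j → Disjoint (σ i) (σ j)) {w : Fin n → ℝ} {V : (Fin r → Fin d → ℤ) →+ ℝ}
    (hV : ∀ j, ∀ i ∈ σ j, V (Pi.single j (a i)) = w i)
    (hV' : ∀ j, ∀ i ∉ σ j, V (Pi.single j (a i)) < w i) (u : Fin n →₀ ℕ)
    (m : Fin r → Fin d → ℤ) (hm : ∑ i, u i • w i ≤ V m) :
    (secantParam K a r (monomial u 1)).coeff m =
      if (∀ i, u i ≠ 0 → ∃ j, i ∈ σ j) ∧ m = leadExponent a σ u then 1 else 0 := by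
  induction u using exponent_induction generalizing m with
  | zero =>
    rw [coeff_secantParam_monomial_zero]
    have : leadExponent a σ 0 = 0 := by
      funext j
      simp [leadExponent]
    simp [this]
  | add_single u i ih =>
    rw [sum_add_single_smul] at hm
    have hVle : ∀ j, V (Pi.single j (a i)) ≤ w i := fun j => by
      by_cases hi : i ∈ σ j
      · exact (hV j i hi).le
      · exact (hV' j i hi).le
    have hle : ∀ j, ∑ i, u i • w i ≤ V (m - Pi.single j (a i)) := fun j => by
      rw [map_sub]
      linarith [hVle j]
    -- a term `t_j^(a i)` with `i ∉ σ j` loses weight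
    have hzero : ∀ j, i ∉ σ j →
        (secantParam K a r (monomial u 1)).coeff (m - Pi.single j (a i)) = 0 := by
      intro j hi
      rw [ih _ (hle j), if_neg]
      rintro ⟨hu, he⟩
      have h1 := weight_leadExponent hσ hV hu
      rw [← he, map_sub] at h1
      linarith [hV' j i hi]
    rw [coeff_secantParam_monomial_add_single]
    by_cases hi : ∃ j, i ∈ σ j
    · obtain ⟨j, hj⟩ := hi
      rw [Finset.sum_eq_single j (fun j' _ hj' => hzero j' fun h =>
        Finset.disjoint_left.1 (hσ j' j hj') h hj) (by simp), ih _ (hle j),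
        leadExponent_add_single hσ hj]
      refine if_congr (and_congr ⟨fun h l hl => ?_, fun h l hl => ?_⟩ sub_eq_iff_eq_add) rfl rfl
      · by_cases hli : l = i
        · exact ⟨j, hli ▸ hj⟩
        · refine h l ?_
          simpa [Finsupp.single_apply, Ne.symm hli] using hl
      · refine h l ?_
        simp [hl]
    · rw [Finset.sum_eq_zero fun j _ => hzero j fun h => hi ⟨j, h⟩, if_neg]
      rintro ⟨h, -⟩
      exact hi (h i (by simp))

theorem leadExponent_injOn {σ : Fin r → Finset (Fin n)}
    (hind : ∀ j, LinearIndependent ℝ (fun i : σ j => fun k => (a i k : ℝ))) {u v : Fin n →₀ ℕ}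
    (hu : ∀ i, u i ≠ 0 → ∃ j, i ∈ σ j) (hv : ∀ i, v i ≠ 0 → ∃ j, i ∈ σ j)
    (h : leadExponent a σ u = leadExponent a σ v) : u = v := by
  have key : ∀ j, ∀ i ∈ σ j, u i = v i := by
    intro j i hi
    have h0 := Fintype.linearIndependent_iff.1 (hind j) (fun i => (u i : ℝ) - v i) (by
      funext k
      have h1 := congrFun (congrFun h j) k
      have h2 : (((leadExponent a σ u j k : ℤ)) : ℝ) - ((leadExponent a σ v j k : ℤ) : ℝ) = 0 := by
        rw [h1, sub_self]
      simp only [leadExponent, Finset.sum_apply, nsmul_eq_mul] at h2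
      push_cast at h2
      rw [← Finset.sum_sub_distrib, ← Finset.sum_coe_sort] at h2
      rw [Finset.sum_apply, Pi.zero_apply, ← h2]
      exact Finset.sum_congr rfl fun l _ => by simp [sub_mul]) ⟨i, hi⟩
    have h1 : (u i : ℝ) = v i := sub_eq_zero.1 h0
    exact_mod_cast h1
  ext i
  by_cases hi : ∃ j, i ∈ σ j
  · obtain ⟨j, hj⟩ := hi
    exact key j i hj
  · rw [not_imp_comm.1 (hu i) hi, not_imp_comm.1 (hv i) hi]

/-- The monomials supported on partitionable sets are linearly independent modulo the secant
ideal. -/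
theorem eq_zero_of_secantParam_eq_zero {Δ : Set (Finset (Fin n))}
    (hΔ : IsRegularTriangulation a Δ) {f : MvPolynomial (Fin n) K}
    (hf : secantParam K a r f = 0)
    (hsupp : ∀ u ∈ f.support, ∃ C, IsPartitionable Δ r C ∧ u.support ⊆ C) : f = 0 := by
  classical
  by_contra hne
  obtain ⟨w, hw, hind⟩ := hΔ
  obtain ⟨u₀, hu₀, hmax⟩ := Finset.exists_max_image f.support (fun u => ∑ i, u i • w i)
    (support_nonempty.2 hne)
  obtain ⟨C, ⟨σ, hσ, hdisj, rfl⟩, hC⟩ := hsupp u₀ hu₀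
  choose c hc hc' using fun j => (hw (σ j)).1 (hσ j).prop
  -- the weight of a Laurent monomial when `t_j` has weight `c j`
  let V : (Fin r → Fin d → ℤ) →+ ℝ :=
    { toFun := fun m => ∑ j, ∑ k, c j k * (m j k : ℝ)
      map_zero' := by simp
      map_add' := fun m m' => by simp [mul_add, Finset.sum_add_distrib] }
  have hVs : ∀ j i, V (Pi.single j (a i)) = ∑ k, c j k * (a i k : ℝ) := by
    intro j i
    change ∑ j', ∑ k, c j' k * ((Pi.single j (a i) : Fin r → Fin d → ℤ) j' k : ℝ) = _
    rw [Finset.sum_eq_single j]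
    · simp
    · intro j' _ hj'
      simp [Pi.single_eq_of_ne hj']
    · simp
  have hV : ∀ j, ∀ i ∈ σ j, V (Pi.single j (a i)) = w i := fun j i hi => by
    rw [hVs, hc j i hi]
  have hV' : ∀ j, ∀ i ∉ σ j, V (Pi.single j (a i)) < w i := fun j i hi => by
    rw [hVs]
    exact hc' j i hi
  have hu₀C : ∀ i, u₀ i ≠ 0 → ∃ j, i ∈ σ j := fun i hi => by
    obtain ⟨j, -, hj⟩ := Finset.mem_biUnion.1 (hC (Finsupp.mem_support_iff.2 hi))
    exact ⟨j, hj⟩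
  have hcoeff := coeff_secantParam (a := a) f (leadExponent a σ u₀)
  rw [hf, AddMonoidAlgebra.coeff_zero, Finsupp.zero_apply, Finset.sum_eq_single u₀] at hcoeff
  · rw [coeff_secantParam_monomial_of_weight_le hdisj hV hV' u₀ _
      (weight_leadExponent hdisj hV hu₀C).ge, if_pos ⟨hu₀C, rfl⟩, mul_one] at hcoeff
    exact mem_support_iff.1 hu₀ hcoeff.symm
  · intro u hu hne
    rw [coeff_secantParam_monomial_of_weight_le hdisj hV hV' u _
      ((hmax u hu).trans (weight_leadExponent hdisj hV hu₀C).ge), if_neg, mul_zero]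
    rintro ⟨huC, he⟩
    exact hne (leadExponent_injOn (fun j => hind _ (hσ j).prop) huC hu₀C he.symm)
  · intro h
    exact absurd hu₀ h

end LeadingTerm

/-! ### The Hilbert function of the secant ideal -/

section SecantHilbertFunction

variable {K : Type*} [Field K] {n d r : ℕ} {a : Fin n → Fin d → ℤ}

/-- A relation between `u` and `m` that is preserved by multiplication with a term `t_j^(a i)` of the
image of `x_i` holds for every exponent `m` that occurs in the image of `x^u`. -/
theorem secantParam_support_induction {P : (Fin n →₀ ℕ) → (Fin r → Fin d → ℤ) → Prop}
    (zero : P 0 0) (add_single : ∀ u m i j, P u m →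
      P (u + Finsupp.single i 1) (m + Pi.single j (a i)))
    {u : Fin n →₀ ℕ} {m : Fin r → Fin d → ℤ}
    (h : (secantParam K a r (monomial u 1)).coeff m ≠ 0) : P u m := by
  induction u using exponent_induction generalizing m with
  | zero =>
    rw [coeff_secantParam_monomial_zero, ite_ne_right_iff] at h
    rwa [h.1]
  | add_single u i ih =>
    rw [coeff_secantParam_monomial_add_single] at h
    obtain ⟨j, -, hj⟩ := Finset.exists_ne_zero_of_sum_ne_zero h
    have := add_single u _ i j (ih hj)
    rwa [sub_add_cancel] at this

theorem sum_mul_eq_degree_of_coeff_ne_zero {ω : Fin d → ℚ}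
    (hω : ∀ i, ∑ k, ω k * (a i k : ℚ) = 1) {u : Fin n →₀ ℕ} {m : Fin r → Fin d → ℤ}
    (h : (secantParam K a r (monomial u 1)).coeff m ≠ 0) :
    ∑ p : Fin r × Fin d, ω p.2 * (m p.1 p.2 : ℚ) = u.degree := by
  refine secantParam_support_induction (P := fun u m =>
    ∑ p : Fin r × Fin d, ω p.2 * (m p.1 p.2 : ℚ) = u.degree) (by simp) ?_ h
  intro u m i j hu
  rw [map_add, Finsupp.degree_single, Nat.cast_add, ← hu, Nat.cast_one, ← hω i]
  simp only [Pi.add_apply, Int.cast_add, mul_add, Finset.sum_add_distrib]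
  congr 1
  rw [Fintype.sum_prod_type, Finset.sum_eq_single j]
  · simp
  · intro j' _ hj'
    simp [Pi.single_eq_of_ne hj']
  · simp

theorem natAbs_le_of_coeff_ne_zero {B : ℕ} (hB : ∀ i k, (a i k).natAbs ≤ B) {u : Fin n →₀ ℕ}
    {m : Fin r → Fin d → ℤ} (h : (secantParam K a r (monomial u 1)).coeff m ≠ 0) (j : Fin r)
    (k : Fin d) : (m j k).natAbs ≤ B * u.degree := by
  refine secantParam_support_induction (P := fun u m =>
    ∀ j k, (m j k).natAbs ≤ B * u.degree) (by simp) ?_ h j k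
  intro u m i j hu j' k
  rw [map_add, Finsupp.degree_single, mul_add, mul_one, Pi.add_apply, Pi.add_apply]
  refine (Int.natAbs_add_le _ _).trans (add_le_add (hu j' k) ?_)
  by_cases hj : j' = j
  · subst hj
    simpa using hB i k
  · simp [Pi.single_eq_of_ne hj]

theorem homogeneousComponent_mem_ker_secantParam
    (hω : ∃ ω : Fin d → ℚ, ∀ i, ∑ k, ω k * (a i k : ℚ) = 1) :
    ∀ f ∈ RingHom.ker (secantParam K a r), ∀ k,
      homogeneousComponent k f ∈ RingHom.ker (secantParam K a r) := by
  classical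
  obtain ⟨ω, hω⟩ := hω
  intro f hf k
  have key : ∀ (g : MvPolynomial (Fin n) K) (m : Fin r → Fin d → ℤ),
      (secantParam K a r (homogeneousComponent k g)).coeff m =
        if ∑ p : Fin r × Fin d, ω p.2 * (m p.1 p.2 : ℚ) = k then
          (secantParam K a r g).coeff m else 0 := by
    intro g m
    induction g using MvPolynomial.induction_on' with
    | add p q hp hq =>
      rw [map_add, map_add, map_add, AddMonoidAlgebra.coeff_add, AddMonoidAlgebra.coeff_add,
        Finsupp.add_apply, Finsupp.add_apply, hp, hq]
      split_ifs <;> simp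
    | monomial u c =>
      rw [homogeneousComponent_of_mem (isHomogeneous_monomial c rfl),
        show monomial u c = c • monomial u (1 : K) by rw [smul_monomial, smul_eq_mul, mul_one]]
      by_cases h0 : (secantParam K a r (monomial u 1)).coeff m = 0
      · split_ifs <;> simp [h0]
      · rw [sum_mul_eq_degree_of_coeff_ne_zero hω h0]
        by_cases hk : k = u.degree
        · simp [hk]
        · have : ¬ ((u.degree : ℚ) = k) := fun h => hk (by exact_mod_cast h.symm)
          simp [hk, this]
  rw [RingHom.mem_ker] at hf ⊢
  ext m
  rw [key, hf]
  simp

theorem hilbertFunction_ker {M : Type*} [AddCommMonoid M]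
    (φ : MvPolynomial (Fin n) K →ₐ[K] AddMonoidAlgebra K M) (k : ℕ) :
    hilbertFunction (RingHom.ker φ) k =
      Module.finrank K ((homogeneousSubmodule (Fin n) K k).map φ.toLinearMap) := by
  have hinj : Function.Injective (Ideal.kerLiftAlg φ).toLinearMap := Ideal.kerLiftAlg_injective φ
  have hcomp : (Ideal.kerLiftAlg φ).toLinearMap ∘ₗ
      (Ideal.Quotient.mkₐ K (RingHom.ker φ)).toLinearMap = φ.toLinearMap :=
    LinearMap.ext fun f => Ideal.kerLiftAlg_mk φ f
  rw [hilbertFunction, (Submodule.equivMapOfInjective _ hinj _).finrank_eq, ← Submodule.map_comp,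
    hcomp]

/-- The Laurent monomials in the image of the forms of degree `k` have exponents in a box of side
`O(k)`, on the hyperplane where the sum of the values of `ω` is `k`. -/
theorem hilbertFunction_ker_secantParam_le (hr : 1 ≤ r) (hn : 0 < n)
    (hω : ∃ ω : Fin d → ℚ, ∀ i, ∑ k, ω k * (a i k : ℚ) = 1) :
    ∃ c : ℚ, ∀ k, (hilbertFunction (RingHom.ker (secantParam K a r)) k : ℚ) ≤
      c * ((k : ℚ) + 1) ^ (r * d - 1) := by
  classical
  obtain ⟨ω, hω⟩ := hω
  obtain ⟨k₀, hk₀⟩ : ∃ k, ω k ≠ 0 := by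
    by_contra! h
    have := hω ⟨0, hn⟩
    simp [h] at this
  obtain ⟨B, hB⟩ : ∃ B : ℕ, ∀ i k, (a i k).natAbs ≤ B :=
    ⟨∑ i, ∑ k, (a i k).natAbs, fun i k =>
      (Finset.single_le_sum (f := fun k => (a i k).natAbs) (fun _ _ => Nat.zero_le _)
        (Finset.mem_univ k)).trans (Finset.single_le_sum (f := fun i => ∑ k, (a i k).natAbs)
          (fun _ _ => Nat.zero_le _) (Finset.mem_univ i))⟩
  let p₀ : Fin r × Fin d := (⟨0, hr⟩, k₀)
  -- `ω k₀ ≠ 0`, so on the hyperplane of degree `k` the coordinate `p₀` is determined by the others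
  refine ⟨(2 * B + 1) ^ (r * d - 1), fun k => ?_⟩
  let I : Finset ℤ := Finset.Icc (-((B * k : ℕ) : ℤ)) ((B * k : ℕ) : ℤ)
  let T : Finset (Fin r → Fin d → ℤ) :=
    (Fintype.piFinset fun _ => Fintype.piFinset fun _ => I).filter fun m =>
      ∑ p : Fin r × Fin d, ω p.2 * (m p.1 p.2 : ℚ) = k
  have hT : T.card ≤ (2 * (B * k) + 1) ^ (r * d - 1) := by
    have hcard : (Fintype.piFinset fun _ : {p : Fin r × Fin d // p ≠ p₀} => I).card =
        (2 * (B * k) + 1) ^ (r * d - 1) := by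
      have hI : I.card = 2 * (B * k) + 1 := by
        rw [Int.card_Icc]
        omega
      rw [Fintype.card_piFinset, Finset.prod_const, Finset.card_univ, hI,
        Fintype.card_subtype_compl]
      simp only [Fintype.card_prod, Fintype.card_fin, Fintype.card_unique]
    rw [← hcard]
    refine Finset.card_le_card_of_injOn (fun m p => m p.1.1 p.1.2) (fun m hm => ?_) ?_
    · have := (Finset.mem_filter.1 hm).1
      rw [Fintype.mem_piFinset] at this
      simp only [Finset.mem_coe, Fintype.mem_piFinset]
      exact fun p => Fintype.mem_piFinset.1 (this p.1.1) p.1.2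
    · intro m hm m' hm' h
      have hoff : ∀ p, p ≠ p₀ → m p.1 p.2 = m' p.1 p.2 := fun p hp => congrFun h ⟨p, hp⟩
      have h1 := (Finset.mem_filter.1 hm).2.trans (Finset.mem_filter.1 hm').2.symm
      rw [← sub_eq_zero, ← Finset.sum_sub_distrib, Finset.sum_eq_single p₀
        (fun p _ hp => by rw [hoff p hp, sub_self]) (by simp), ← mul_sub] at h1
      have h2 : (m p₀.1 p₀.2 : ℚ) = m' p₀.1 p₀.2 :=
        sub_eq_zero.1 ((mul_eq_zero.1 h1).resolve_left hk₀)
      funext j l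
      by_cases hp : (j, l) = p₀
      · have e : m p₀.1 p₀.2 = m' p₀.1 p₀.2 := by exact_mod_cast h2
        rw [← hp] at e
        exact e
      · exact hoff (j, l) hp
  have hle : (homogeneousSubmodule (Fin n) K k).map (secantParam K a r).toLinearMap ≤
      Submodule.span K (T.image fun m =>
        (AddMonoidAlgebra.single m 1 : AddMonoidAlgebra K (Fin r → Fin d → ℤ))) := by
    rintro _ ⟨f, hf, rfl⟩
    rw [AlgHom.toLinearMap_apply, ← AddMonoidAlgebra.sum_coeff_single (secantParam K a r f)]
    refine Submodule.sum_mem _ fun m hm => ?_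
    have hm' := Finsupp.mem_support_iff.1 hm
    rw [coeff_secantParam] at hm'
    obtain ⟨u, hu, hum⟩ := Finset.exists_ne_zero_of_sum_ne_zero hm'
    have hum' := right_ne_zero_of_mul hum
    have hdeg : u.degree = k := by
      by_contra hne
      exact mem_support_iff.1 hu (IsHomogeneous.coeff_eq_zero hf hne)
    have hmT : m ∈ T := by
      refine Finset.mem_filter.2 ⟨?_, by rw [sum_mul_eq_degree_of_coeff_ne_zero hω hum', hdeg]⟩
      simp only [Fintype.mem_piFinset]
      intro j l
      have := natAbs_le_of_coeff_ne_zero hB hum' j l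
      rw [hdeg] at this
      rw [Finset.mem_Icc]
      omega
    rw [show ∀ c : K, AddMonoidAlgebra.single m c = c • (AddMonoidAlgebra.single m (1 : K)) from
      fun c => by rw [AddMonoidAlgebra.smul_single, smul_eq_mul, mul_one]]
    refine Submodule.smul_mem _ _ (Submodule.subset_span ?_)
    exact Finset.mem_coe.2 (Finset.mem_image_of_mem _ hmT)
  have h1 : hilbertFunction (RingHom.ker (secantParam K a r)) k ≤
      (2 * (B * k) + 1) ^ (r * d - 1) := by
    rw [hilbertFunction_ker]
    exact (Submodule.finrank_mono hle).trans ((finrank_span_finset_le_card _).trans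
      (Finset.card_image_le.trans hT))
  rw [← mul_pow]
  refine (Nat.cast_le.2 h1).trans ?_
  push_cast
  refine pow_le_pow_left₀ (by positivity) ?_ _
  have : (0 : ℚ) ≤ B := by positivity
  have : (0 : ℚ) ≤ k := by positivity
  nlinarith

theorem card_le_hilbertFunction_ker_secantParam {Δ : Set (Finset (Fin n))}
    (hΔ : IsRegularTriangulation a Δ) {k : ℕ} (U : Finset (Fin n →₀ ℕ))
    (hdeg : ∀ u ∈ U, u.degree = k) (hU : ∀ u ∈ U, ∃ C, IsPartitionable Δ r C ∧ u.support ⊆ C) :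
    U.card ≤ hilbertFunction (RingHom.ker (secantParam K a r)) k := by
  classical
  have hli : LinearIndependent K fun u : U => secantParam K a r (monomial u.1 1) := by
    rw [Fintype.linearIndependent_iff]
    intro c hc u
    set f : MvPolynomial (Fin n) K := ∑ v : U, monomial v.1 (c v) with hf
    have hcoeff : ∀ v : Fin n →₀ ℕ, f.coeff v = if h : v ∈ U then c ⟨v, h⟩ else 0 := by
      intro v
      rw [hf, coeff_sum]
      simp only [coeff_monomial]
      split_ifs with h
      · rw [Finset.sum_eq_single ⟨v, h⟩]
        · simp
        · intro v' _ hv'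
          rw [if_neg fun e => hv' (Subtype.ext e)]
        · simp
      · exact Finset.sum_eq_zero fun v' _ => if_neg fun (e : v'.1 = v) => h (e ▸ v'.2)
    have hf0 : f = 0 := by
      refine eq_zero_of_secantParam_eq_zero (a := a) (r := r) hΔ ?_ fun v hv => hU v ?_
      · rw [hf, map_sum, ← hc]
        refine Finset.sum_congr rfl fun v _ => ?_
        rw [← map_smul, smul_monomial, smul_eq_mul, mul_one]
      · by_contra h
        rw [mem_support_iff, hcoeff, dif_neg h] at hv
        exact hv rfl
    have := hcoeff u
    rw [hf0, coeff_zero, dif_pos u.2] at this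
    exact this.symm
  rw [hilbertFunction_ker, ← Fintype.card_coe, ← finrank_span_eq_card hli]
  refine Submodule.finrank_mono (Submodule.span_le.2 ?_)
  rintro _ ⟨u, rfl⟩
  exact ⟨_, isHomogeneous_monomial 1 (hdeg u u.2), rfl⟩

/-- The monomials of degree `k` whose support is exactly a given `C` correspond to the
compositions of `k` into `#C` positive parts. -/
theorem ncard_mul_choose_le_hilbertFunction {Δ : Set (Finset (Fin n))}
    (hrank : Submodule.span ℚ (Set.range fun i => fun k => (a i k : ℚ)) = ⊤)
    (hΔ : IsRegularTriangulation a Δ) (hrd : 0 < r * d) {k : ℕ} (hk : r * d - 1 < k) :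
    {C | IsPartitionable Δ r C}.ncard * (k - 1).choose (r * d - 1) ≤
      hilbertFunction (RingHom.ker (secantParam K a r)) k := by
  classical
  let P : Finset (Finset (Fin n)) := Finset.univ.filter (IsPartitionable Δ r)
  have hP : {C | IsPartitionable Δ r C}.ncard = P.card := by
    rw [← Set.ncard_coe_finset]
    congr 1
    ext C
    simp [P]
  let e : Finset (Fin n) → (Fin n →₀ ℕ) := fun C =>
    Finsupp.equivFunOnFinite.symm fun i => if i ∈ C then 1 else 0
  let A : Finset (Σ _ : Finset (Fin n), Fin n →₀ ℕ) :=
    P.sigma fun C => C.finsuppAntidiag (k - r * d)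
  have hsupp : ∀ x ∈ A, (x.2 + e x.1).support = x.1 := by
    intro x hx
    have hx2 := Finset.mem_finsuppAntidiag.1 (Finset.mem_sigma.1 hx).2
    ext i
    rw [Finsupp.mem_support_iff]
    by_cases hi : i ∈ x.1
    · simp [e, hi]
    · simpa [e, hi] using fun h => hi (hx2.2 (Finsupp.mem_support_iff.2 h))
  have hA : A.card = P.card * (k - 1).choose (r * d - 1) := by
    rw [Finset.card_sigma, Finset.sum_congr rfl fun C hC => ?_, Finset.sum_const, smul_eq_mul]
    rw [Finset.card_finsuppAntidiag_nat_eq_choose,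
      (Finset.mem_filter.1 hC).2.card_eq hrank hΔ,
      show r * d + (k - r * d) - 1 = k - 1 by omega, ← Nat.choose_symm (by omega)]
    congr 1
    omega
  rw [hP, ← hA, ← Finset.card_image_of_injOn (f := fun x => x.2 + e x.1)]
  · refine card_le_hilbertFunction_ker_secantParam hΔ _ (fun u hu => ?_) fun u hu => ?_
    · obtain ⟨x, hx, rfl⟩ := Finset.mem_image.1 hu
      obtain ⟨hx1, hx2⟩ := Finset.mem_sigma.1 hx
      have hcard := (Finset.mem_filter.1 hx1).2.card_eq hrank hΔ
      have h1 : x.2.degree = k - r * d := by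
        rw [← (Finset.mem_finsuppAntidiag.1 hx2).1, Finsupp.degree_apply]
        exact Finset.sum_subset (Finset.mem_finsuppAntidiag.1 hx2).2 fun i _ hi =>
          Finsupp.notMem_support_iff.1 hi
      have h2 : (e x.1).degree = r * d := by
        rw [Finsupp.degree_eq_sum, ← hcard]
        simp [e]
      rw [map_add, h1, h2]
      omega
    · obtain ⟨x, hx, rfl⟩ := Finset.mem_image.1 hu
      exact ⟨x.1, (Finset.mem_filter.1 (Finset.mem_sigma.1 hx).1).2, (hsupp x hx).le⟩
  · rintro ⟨C, u⟩ hx ⟨C', u'⟩ hx' h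
    have h1 := hsupp _ hx
    have h2 := hsupp _ hx'
    dsimp only at h h1 h2
    rw [h, h2] at h1
    subst h1
    rw [add_right_cancel h]

end SecantHilbertFunction

/-! ### The dimension of the secant ideal -/

section SecantDimension

variable {K : Type*} [Field K] {n d r : ℕ} {a : Fin n → Fin d → ℤ}

/-- The Laurent polynomial ring in `r * d` unknowns is algebraic over the polynomial ring. -/
theorem trdeg_laurent_le (K : Type*) [Field K] (r d : ℕ) :
    Algebra.trdeg K (AddMonoidAlgebra K (Fin r → Fin d → ℤ)) ≤ ((r * d : ℕ) : Cardinal) := by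
  classical
  let e : Fin r × Fin d → (Fin r → Fin d → ℤ) := fun p => Pi.single p.1 (Pi.single p.2 1)
  let t : Fin r × Fin d → AddMonoidAlgebra K (Fin r → Fin d → ℤ) :=
    fun p => AddMonoidAlgebra.single (e p) 1
  let A := Algebra.adjoin K (Set.range t)
  let H : AddSubmonoid (Fin r → Fin d → ℤ) :=
    { carrier := {m | IsAlgebraic A (AddMonoidAlgebra.single m (1 : K))}
      zero_mem' := by
        change IsAlgebraic A (1 : AddMonoidAlgebra K (Fin r → Fin d → ℤ))
        exact isAlgebraic_one
      add_mem' := fun {m m'} hm hm' => by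
        have := IsAlgebraic.mul hm hm'
        rwa [AddMonoidAlgebra.single_mul_single, mul_one] at this }
  have ht : ∀ p, t p ∈ A := fun p => Algebra.subset_adjoin ⟨p, rfl⟩
  have hpos : ∀ p, e p ∈ H := fun p =>
    isAlgebraic_algebraMap (A := AddMonoidAlgebra K (Fin r → Fin d → ℤ)) (⟨t p, ht p⟩ : A)
  have hneg : ∀ p, -e p ∈ H := by
    intro p
    -- the inverse of `t p` is a root of `t p * X - 1`
    refine ⟨Polynomial.C ⟨t p, ht p⟩ * Polynomial.X - 1, fun h => ?_, ?_⟩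
    · have := congrArg (Polynomial.eval 0) h
      simp at this
    · simp only [map_sub, map_mul, Polynomial.aeval_C, Polynomial.aeval_X, map_one]
      change t p * _ - 1 = 0
      rw [AddMonoidAlgebra.single_mul_single, add_neg_cancel, mul_one, AddMonoidAlgebra.one_def,
        sub_self]
  have hH : ∀ m, m ∈ H := by
    intro m
    have hm : m = ∑ p : Fin r × Fin d, m p.1 p.2 • e p := by
      funext j k
      simp only [Finset.sum_apply, Pi.smul_apply, e]
      rw [Finset.sum_eq_single (j, k)]
      · simp
      · rintro ⟨j', k'⟩ _ hne
        by_cases hj : j = j'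
        · subst hj
          have hk : k ≠ k' := fun h => hne (by rw [h])
          simp [Pi.single_eq_of_ne hk]
        · simp [Pi.single_eq_of_ne hj]
      · simp
    rw [hm]
    refine sum_mem fun p _ => ?_
    obtain ⟨z, hz | hz⟩ := Int.eq_nat_or_neg (m p.1 p.2)
    · rw [hz, natCast_zsmul]
      exact nsmul_mem (hpos p) z
    · rw [hz, neg_smul, ← smul_neg, natCast_zsmul]
      exact nsmul_mem (hneg p) z
  have halg : Algebra.IsAlgebraic A (AddMonoidAlgebra K (Fin r → Fin d → ℤ)) := by
    refine ⟨fun x => ?_⟩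
    induction x using AddMonoidAlgebra.induction_linear with
    | zero => exact isAlgebraic_zero
    | add f g hf hg => exact hf.add hg
    | single m c =>
      have h1 : (AddMonoidAlgebra.single m c : AddMonoidAlgebra K (Fin r → Fin d → ℤ)) =
          algebraMap A _ (algebraMap K A c) * AddMonoidAlgebra.single m 1 := by
        rw [← IsScalarTower.algebraMap_apply, ← Algebra.smul_def, AddMonoidAlgebra.smul_single,
          smul_eq_mul, mul_one]
      rw [h1]
      exact (isAlgebraic_algebraMap _).mul (hH m)
  refine (Algebra.IsAlgebraic.trdeg_le_cardinalMk K (Set.range t)).trans ?_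
  have := Cardinal.mk_range_le_lift (f := t)
  simpa using this

theorem trdeg_quotient_ker_secantParam
    (hrank : Submodule.span ℚ (Set.range fun i => fun k => (a i k : ℚ)) = ⊤)
    {Δ : Set (Finset (Fin n))} (hΔ : IsRegularTriangulation a Δ)
    (hC : ∃ C, IsPartitionable Δ r C) :
    Algebra.trdeg K (MvPolynomial (Fin n) K ⧸ RingHom.ker (secantParam K a r)) =
      ((r * d : ℕ) : Cardinal) := by
  apply le_antisymm
  · exact (trdeg_le_of_injective _ (Ideal.kerLiftAlg_injective (secantParam K a r))).trans
      (trdeg_laurent_le K r d)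
  · obtain ⟨C, hC⟩ := hC
    have hind : AlgebraicIndependent K fun i : C =>
        Ideal.Quotient.mkₐ K (RingHom.ker (secantParam K a r)) (X i.1) := by
      rw [algebraicIndependent_iff]
      intro p hp
      have h1 : aeval (fun i : C => Ideal.Quotient.mkₐ K (RingHom.ker (secantParam K a r))
          (X i.1)) p = Ideal.Quotient.mkₐ K (RingHom.ker (secantParam K a r))
            (rename Subtype.val p) := by
        rw [← AlgHom.comp_apply]
        congr 1
        ext i : 1
        simp
      rw [h1, Ideal.Quotient.mkₐ_eq_mk, Ideal.Quotient.eq_zero_iff_mem, RingHom.mem_ker] at hp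
      have h2 := eq_zero_of_secantParam_eq_zero hΔ hp fun u hu => ⟨C, hC, fun i hi => ?_⟩
      · exact rename_injective _ Subtype.val_injective (h2.trans (map_zero _).symm)
      · classical
        have h3 := vars_rename Subtype.val p ((mem_vars_iff_mem_support _).2 ⟨u, hu, hi⟩)
        obtain ⟨i', -, rfl⟩ := Finset.mem_image.1 h3
        exact i'.2
    have h := hind.lift_cardinalMk_le_trdeg
    rw [Cardinal.mk_coe_finset, hC.card_eq hrank hΔ] at h
    simpa using h

theorem hasProjDim_ker_secantParam
    (hrank : Submodule.span ℚ (Set.range fun i => fun k => (a i k : ℚ)) = ⊤)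
    {Δ : Set (Finset (Fin n))} (hΔ : IsRegularTriangulation a Δ)
    (hC : ∃ C, IsPartitionable Δ r C) (hrd : 0 < r * d) :
    HasProjDim (RingHom.ker (secantParam K a r)) (expectedDim n d r) := by
  have hle : r * d ≤ n := by
    obtain ⟨C, hC⟩ := hC
    rw [← hC.card_eq hrank hΔ]
    simpa using C.card_le_univ
  have := RingHom.ker_isPrime (secantParam K a r)
  rw [HasProjDim, ringKrullDim_eq_of_trdeg_eq K _ (trdeg_quotient_ker_secantParam hrank hΔ hC),
    show expectedDim n d r + 1 = r * d by unfold expectedDim; omega]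

end SecantDimension

/-! ### The secant variety over an algebraically closed field -/

section SecantVariety

variable {K : Type*} [Field K] {n d r : ℕ} {a : Fin n → Fin d → ℤ}

/-- Evaluation of Laurent polynomials at a point of the torus. -/
noncomputable def torusEval (t : Fin r → Fin d → Kˣ) :
    AddMonoidAlgebra K (Fin r → Fin d → ℤ) →ₐ[K] K :=
  AddMonoidAlgebra.lift K K (Fin r → Fin d → ℤ)
    { toFun := fun m => ((∏ j, ∏ k, t j k ^ (m.toAdd j k) : Kˣ) : K)
      map_one' := by simp
      map_mul' := fun m m' => by
        simp [zpow_add, Finset.prod_mul_distrib] }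

theorem torusEval_single (t : Fin r → Fin d → Kˣ) (m : Fin r → Fin d → ℤ) (c : K) :
    torusEval t (AddMonoidAlgebra.single m c) = c * ((∏ j, ∏ k, t j k ^ m j k : Kˣ) : K) := by
  simp [torusEval, AddMonoidAlgebra.lift_single]

/-- Over an infinite field distinct Laurent monomials are distinct characters of the torus, hence
linearly independent. -/
theorem eq_zero_of_forall_torusEval_eq_zero [Infinite K]
    {f : AddMonoidAlgebra K (Fin r → Fin d → ℤ)} (hf : ∀ t, torusEval t f = 0) : f = 0 := by
  classical
  let χ : (Fin r → Fin d → ℤ) → ((Fin r → Fin d → Kˣ) →* K) := fun m =>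
    { toFun := fun t => ((∏ j, ∏ k, t j k ^ m j k : Kˣ) : K)
      map_one' := by simp
      map_mul' := fun t t' => by simp [mul_zpow, Finset.prod_mul_distrib] }
  have hunit : ∀ z : ℤ, (∀ x : Kˣ, x ^ z = 1) → z = 0 := by
    intro z hz
    by_contra hne
    have hpos : 0 < z.natAbs := Int.natAbs_pos.2 hne
    have hz' : ∀ x : Kˣ, x ^ z.natAbs = 1 := fun x => by
      rcases Int.natAbs_eq z with h | h
      · have := hz x
        rwa [h, zpow_natCast] at this
      · have := hz x
        rwa [h, zpow_neg, zpow_natCast, inv_eq_one] at this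
    have hfin : (Set.range ((↑) : Kˣ → K)).Finite := by
      refine ((Polynomial.nthRoots z.natAbs (1 : K)).toFinset.finite_toSet).subset ?_
      rintro _ ⟨x, rfl⟩
      simp only [Finset.mem_coe, Multiset.mem_toFinset, Polynomial.mem_nthRoots hpos]
      rw [← Units.val_pow_eq_pow_val, hz' x, Units.val_one]
    have huniv : (Set.univ : Set K) ⊆ insert 0 (Set.range ((↑) : Kˣ → K)) := fun x _ => by
      by_cases hx : x = 0
      · exact Or.inl hx
      · exact Or.inr ⟨Units.mk0 x hx, rfl⟩
    exact Set.infinite_univ ((hfin.insert 0).subset huniv)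
  have hχ : Function.Injective χ := by
    intro m m' h
    funext j k
    rw [← sub_eq_zero]
    refine hunit _ fun x => ?_
    let t : Fin r → Fin d → Kˣ := Pi.mulSingle j (Pi.mulSingle k x)
    have hval : ∀ m : Fin r → Fin d → ℤ, χ m t = ((x ^ m j k : Kˣ) : K) := by
      intro m
      change ((∏ j', ∏ k', t j' k' ^ m j' k' : Kˣ) : K) = _
      congr 1
      rw [Finset.prod_eq_single j, Finset.prod_eq_single k]
      · simp [t]
      · intro k' _ hk'
        simp [t, Pi.mulSingle_eq_of_ne hk']
      · simp
      · intro j' _ hj'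
        simp [t, Pi.mulSingle_eq_of_ne hj']
      · simp
    have h1 := DFunLike.congr_fun h t
    rw [hval, hval] at h1
    rw [zpow_sub, Units.val_injective h1, mul_inv_cancel]
  have hli := (linearIndependent_monoidHom (Fin r → Fin d → Kˣ) K).comp χ hχ
  have h0 : f.coeff = 0 := by
    refine linearIndependent_iff.1 hli f.coeff ?_
    funext t
    have h1 := hf t
    rw [← AddMonoidAlgebra.sum_coeff_single f] at h1
    rw [Finsupp.linearCombination_apply, Finsupp.sum, Finset.sum_apply, Pi.zero_apply, ← h1,
      Finsupp.sum, map_sum]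
    refine Finset.sum_congr rfl fun m _ => ?_
    rw [torusEval_single]
    rfl
  exact AddMonoidAlgebra.coeff_eq_zero.1 h0

theorem projVanishingIdeal_zariskiClosure (S : Set (ℙ K (Fin n → K))) :
    projVanishingIdeal (zariskiClosure S) = projVanishingIdeal S := by
  apply le_antisymm
  · refine vanishingIdeal_anti_mono ?_
    rintro v ⟨p, hp, hv⟩
    refine ⟨p, fun f hf w hw => ?_, hv⟩
    have := hf w ⟨p, hp, hw⟩
    rwa [aeval_eq_eval] at this
  · rintro f hf v ⟨p, hp, hv⟩
    have := hp f hf v hv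
    rwa [aeval_eq_eval]

/-- The point of the affine cone over a toric variety with torus coordinates `t`. -/
def torusPoint (a : Fin n → Fin d → ℤ) (t : Fin d → Kˣ) : Fin n → K :=
  fun i => ((∏ k, t k ^ a i k : Kˣ) : K)

theorem torusPoint_ne_zero (hn : 0 < n) (t : Fin d → Kˣ) : torusPoint a t ≠ 0 := fun h =>
  Units.ne_zero _ (congrFun h ⟨0, hn⟩)

theorem torusEval_secantParam (t : Fin r → Fin d → Kˣ) (f : MvPolynomial (Fin n) K) :
    torusEval t (secantParam K a r f) = eval (∑ j, torusPoint a (t j)) f := by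
  rw [← aeval_eq_eval, ← AlgHom.comp_apply]
  congr 1
  ext i : 1
  rw [AlgHom.comp_apply, secantParam, aeval_X, aeval_X, map_sum, Finset.sum_apply]
  refine Finset.sum_congr rfl fun j _ => ?_
  rw [torusEval_single, one_mul, torusPoint]
  congr 1
  rw [Finset.prod_eq_single j]
  · simp
  · intro j' _ hj'
    simp [Pi.single_eq_of_ne hj']
  · simp

theorem toricIdeal_eq_ker_secantParam_one : toricIdeal K a = RingHom.ker (secantParam K a 1) := by
  let θ : AddMonoidAlgebra K (Fin d → ℤ) →ₐ[K] AddMonoidAlgebra K (Fin 1 → Fin d → ℤ) :=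
    AddMonoidAlgebra.mapDomainAlgHom K K (AddMonoidHom.single (fun _ => Fin d → ℤ) 0)
  have hθ : Function.Injective θ :=
    AddMonoidAlgebra.mapDomain_injective fun x y h => by
      simpa using congrFun (h : (Pi.single 0 x : Fin 1 → Fin d → ℤ) = Pi.single 0 y) 0
  have h : secantParam K a 1 = θ.comp (aeval fun i =>
      (AddMonoidAlgebra.single (a i) 1 : AddMonoidAlgebra K (Fin d → ℤ))) := by
    ext i : 1
    simp [θ, secantParam]
  ext f
  rw [RingHom.mem_ker, h, AlgHom.comp_apply, map_eq_zero_iff θ hθ]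
  rfl

theorem eval_smul_of_isHomogeneous {f : MvPolynomial (Fin n) K} {k : ℕ} (hf : f.IsHomogeneous k)
    (c : K) (v : Fin n → K) : eval (c • v) f = c ^ k * eval v f := by
  rw [eval_eq', eval_eq', Finset.mul_sum]
  refine Finset.sum_congr rfl fun u hu => ?_
  have hk : ∑ i, u i = k := by
    rw [← Finsupp.degree_eq_sum]
    by_contra h
    exact mem_support_iff.1 hu (hf.coeff_eq_zero h)
  simp only [Pi.smul_apply, smul_eq_mul, mul_pow, Finset.prod_mul_distrib,
    Finset.prod_pow_eq_pow_sum, hk]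
  ring

theorem mk_torusPoint_mem_projZeroLocus (hn : 0 < n)
    (hω : ∃ ω : Fin d → ℚ, ∀ i, ∑ k, ω k * (a i k : ℚ) = 1) (t : Fin d → Kˣ) :
    Projectivization.mk K (torusPoint a t) (torusPoint_ne_zero hn t) ∈
      projZeroLocus (toricIdeal K a) := by
  intro f hf v hv
  rw [Projectivization.submodule_mk, Submodule.mem_span_singleton] at hv
  obtain ⟨c, rfl⟩ := hv
  rw [toricIdeal_eq_ker_secantParam_one] at hf
  rw [← sum_homogeneousComponent f, map_sum]
  refine Finset.sum_eq_zero fun k _ => ?_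
  have hk := homogeneousComponent_mem_ker_secantParam hω f hf k
  have h0 := torusEval_secantParam (a := a) (fun _ : Fin 1 => t) (homogeneousComponent k f)
  rw [RingHom.mem_ker.1 hk, map_zero, Fin.sum_univ_one] at h0
  rw [eval_smul_of_isHomogeneous (homogeneousComponent_isHomogeneous k f), ← h0, mul_zero]

theorem eval_sum_eq_zero_of_mem_secantIdeal {I : Ideal (MvPolynomial (Fin n) K)}
    {f : MvPolynomial (Fin n) K} (hf : f ∈ secantIdeal I r) {v : Fin r → Fin n → K}
    (hv : ∀ j, ∀ g ∈ I, eval (v j) g = 0) : eval (∑ j, v j) f = 0 := by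
  let Φ : MvPolynomial (Fin n ⊕ Fin r × Fin n) K →ₐ[K] K :=
    aeval (Sum.elim (∑ j, v j) fun p => v p.1 p.2)
  have hΦ : Φ (rename Sum.inl f) = 0 := by
    refine (show _ ≤ RingHom.ker Φ from ?_) (Ideal.mem_comap.1 hf)
    refine sup_le (iSup_le fun j => Ideal.map_le_iff_le_comap.2 fun g hg => ?_)
      (Ideal.span_le.2 ?_)
    · rw [Ideal.mem_comap, RingHom.mem_ker, aeval_rename, ← hv j g hg, ← aeval_eq_eval]
      rfl
    · rintro _ ⟨i, rfl⟩
      simp [Φ, RingHom.mem_ker]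
  rw [← hΦ, aeval_rename, ← aeval_eq_eval]
  rfl

theorem projVanishingIdeal_secantVariety [Infinite K] (hn : 0 < n) (hr : 1 ≤ r)
    (hω : ∃ ω : Fin d → ℚ, ∀ i, ∑ k, ω k * (a i k : ℚ) = 1) :
    projVanishingIdeal (secantVariety (projZeroLocus (toricIdeal K a)) r) =
      secantIdeal (toricIdeal K a) r := by
  rw [secantVariety, projVanishingIdeal_zariskiClosure]
  apply le_antisymm
  · intro f hf
    rw [secantIdeal_toricIdeal, RingHom.mem_ker]
    refine eq_zero_of_forall_torusEval_eq_zero fun t => ?_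
    rw [torusEval_secantParam, ← aeval_eq_eval]
    refine hf _ ?_
    let q : Fin r → ℙ K (Fin n → K) := fun j =>
      Projectivization.mk K (torusPoint a (t j)) (torusPoint_ne_zero hn (t j))
    have hq : ∀ j, q j ∈ projZeroLocus (toricIdeal K a) := fun j =>
      mk_torusPoint_mem_projZeroLocus hn hω (t j)
    have hmem : ∑ j, torusPoint a (t j) ∈ ⨆ j, (q j).submodule := by
      refine sum_mem fun j _ => Submodule.mem_iSup_of_mem j ?_
      rw [Projectivization.submodule_mk]
      exact Submodule.mem_span_singleton_self _
    -- the sum may be the origin, which lies on the affine cone but is not a projective point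
    by_cases h0 : ∑ j, torusPoint a (t j) = 0
    · refine ⟨q ⟨0, hr⟩, ⟨q, hq, le_iSup (fun j => (q j).submodule) _⟩, ?_⟩
      rw [h0]
      exact zero_mem _
    · refine ⟨Projectivization.mk K _ h0, ⟨q, hq, ?_⟩, ?_⟩
      · rw [Projectivization.submodule_mk]
        exact (Submodule.span_singleton_le_iff_mem _ _).2 hmem
      · rw [Projectivization.submodule_mk]
        exact Submodule.mem_span_singleton_self _
  · rintro f hf v ⟨p, ⟨q, hq, hp⟩, hv⟩
    obtain ⟨x, hx, rfl⟩ := (Submodule.mem_iSup_iff_exists_finsupp _ _).1 (hp hv)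
    rw [aeval_eq_eval, Finsupp.sum_fintype _ _ (fun _ => rfl)]
    exact eval_sum_eq_zero_of_mem_secantIdeal hf fun j g hg => hq j g hg _ (hx j)

end SecantVariety

end ToricSecant

theorem theorem5p4 {K : Type*} [Field K] {n d : ℕ} (hn : 0 < n)
    (a : Fin n → Fin d → ℤ) (ha : Function.Injective a)
    (hω : ∃ ω : Fin d → ℚ, ∀ i, ∑ k, ω k * (a i k : ℚ) = 1)
    (hrank : Submodule.span ℚ (Set.range fun i => fun k => (a i k : ℚ)) = ⊤)
    (r : ℕ) (hr : 1 ≤ r)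
    (Δ : Set (Finset (Fin n))) (hΔ : ToricSecant.IsRegularTriangulation a Δ)
    (hC : ∃ C, ToricSecant.IsPartitionable Δ r C) :
    -- the projective scheme defined by the secant ideal, over an arbitrary field
    (ToricSecant.HasProjDim (ToricSecant.secantIdeal (ToricSecant.toricIdeal K a) r)
        (ToricSecant.expectedDim n d r) ∧
      ∃ D : ℕ, ToricSecant.HasDegree (ToricSecant.secantIdeal (ToricSecant.toricIdeal K a) r) D ∧
        {C | ToricSecant.IsPartitionable Δ r C}.ncard ≤ D) ∧
    -- the closure of the union of secant planes, over an algebraically closed field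
    (IsAlgClosed K →
      ToricSecant.HasProjDim
        (ToricSecant.projVanishingIdeal (ToricSecant.secantVariety
          (ToricSecant.projZeroLocus (ToricSecant.toricIdeal K a)) r))
        (ToricSecant.expectedDim n d r) ∧
      ∃ D : ℕ, ToricSecant.HasDegree
        (ToricSecant.projVanishingIdeal (ToricSecant.secantVariety
          (ToricSecant.projZeroLocus (ToricSecant.toricIdeal K a)) r)) D ∧
        {C | ToricSecant.IsPartitionable Δ r C}.ncard ≤ D) := by
  have hrd : 0 < r * d := by
    refine Nat.mul_pos hr (Nat.pos_of_ne_zero ?_)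
    rintro rfl
    obtain ⟨ω, hω⟩ := hω
    simpa using hω ⟨0, hn⟩
  have hN : 0 < {C | ToricSecant.IsPartitionable Δ r C}.ncard :=
    (Set.ncard_pos (Set.toFinite _)).2 hC
  obtain ⟨c, hc⟩ := ToricSecant.hilbertFunction_ker_secantParam_le (K := K) hr hn hω
  have hmain := And.intro (ToricSecant.hasProjDim_ker_secantParam (K := K) hrank hΔ hC hrd)
    (ToricSecant.exists_hasDegree_of_hilbertFunction_bounds
      (ToricSecant.homogeneousComponent_mem_ker_secantParam hω) hN
      (fun k hk => ToricSecant.ncard_mul_choose_le_hilbertFunction hrank hΔ hrd hk) hc)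
  rw [← ToricSecant.secantIdeal_toricIdeal] at hmain
  refine ⟨hmain, fun _ => ?_⟩
  have : Infinite K := IsAlgClosed.instInfinite
  rw [ToricSecant.projVanishingIdeal_secantVariety hn hr hω]
  exact hmain
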